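/- Let $n,m\ge 0$ and $N\ge 1$ be integers, $\varepsilon>0$, $A_k\in\mathbb{R}^{n\times n}$, $B_k\in\mathbb{R}^{n\times m}$ for $k=0,\dots,N-1$, $\bar\mu_0,\bar\mu_N\in\mathbb{R}^n$, and let $\bar\Sigma_0,\bar\Sigma_N\in\mathbb{R}^{n\times n}$ be symmetric positive definite. A policy $\pi=\{\pi_k\}_{k=0}^{N-1}$ consists of conditional probability densities $\pi_k(\cdot|x)$ on $\mathbb{R}^m$, jointly measurable in $(x,u)$. Consider the problem $$\underset{\pi}{\text{minimize}}\quad \mathbb{E}\Big[\sum_{k=0}^{N-1}\Big(\tfrac12\|u_k\|^2-\varepsilon H(\pi_k(\cdot|x_k))\Big)\Big],\qquad H(q):=-\int_{\mathbb{R}^m} q(u)\log q(u)\,du,$$ subject to $x_{k+1}=A_kx_k+B_ku_k$, $u_k\sim\pi_k(\cdot|x)$ given $x_k=x$, and to the constraints (with $x_0,x_N$ of finite second moment, not necessarily Gaussian) $$\mathbb{E}[x_0]=\bar\mu_0,\quad \mathbb{E}[(x_0-\bar\mu_0)(x_0-\bar\mu_0)^\top]=\bar\Sigma_0,\quad \mathbb{E}[x_N]=\bar\mu_N,\quad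 \mathbb{E}[(x_N-\bar\mu_N)(x_N-\bar\mu_N)^\top]=\bar\Sigma_N.$$ The cost takes values in $(-\infty,\infty]$; it is $+\infty$ if some $\mathbb{E}\|u_k\|^2$ is infinite. Assume that every $A_k$, $0\le k\le N-1$, is invertible. Let $\Phi(k,l)=A_{k-1}\cdots A_l$ for $k>l$, $\Phi(k,k)=I$, $\Phi(k,l)=A_k^{-1}\cdots A_{l-1}^{-1}$ for $k<l$, and $$G_r(k_1,k_0)=\sum_{k=k_0}^{k_1-1}\Phi(k_1,k+1)B_kB_k^\top\Phi(k_1,k+1)^\top,\qquad G_c(k_1,k_0)=\sum_{k=k_0}^{k_1-1}\Phi(k_0,k+1)B_kB_k^\top\Phi(k_0,k+1)^\top .$$ Assume that there is $k_r\in\{1,\dots,N\}$ such that $G_r(k,0)$ is invertible for $k_r\le k\le N$ and $G_r(N,k)$ is invertible for $0\le k\le k_r-1$. With $G:=G_c(N,0)$ and positive semidefinite square roots, put $$S_0=\tfrac1\varepsilon G^{-1/2}\bar\Sigma_0G^{-1/2},\qquad S_N=\tfrac1\varepsilon G^{-1/2}\Phi(0,N)\bar\Sigma_N\Phi(0,N)^\top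 G^{-1/2},\qquad R=\big(S_0^{1/2}S_NS_0^{1/2}+\tfrac14I\big)^{1/2},$$ and assume that $S_0+\tfrac12I-R$ and $-S_0+\tfrac12I+R$ are invertible. Define $$Q_{-,0}=G^{1/2}S_0^{1/2}\big(S_0+\tfrac12I-R\big)^{-1}S_0^{1/2}G^{1/2},\qquad Q_{-,k+1}=A_kQ_{-,k}A_k^\top-B_kB_k^\top,\qquad \Lambda_k=I+B_k^\top Q_{-,k+1}^{-1}B_k,$$ $$\bar u_k^*=B_k^\top\Phi(N,k+1)^\top G_r(N,0)^{-1}\big(\bar\mu_N-\Phi(N,0)\bar\mu_0\big),\qquad \mu_k^*=\Phi(k,0)\bar\mu_0+\sum_{s=0}^{k-1}\Phi(k,s+1)B_s\bar u_s^* .$$ Then $Q_{-,k}$ is invertible for $0\le k\le N$, $\Lambda_k$ is positive definite for $0\le k\le N-1$, and for every law of $x_0$ with mean $\bar\mu_0$ and covariance $\bar\Sigma_0$ the unique optimal policy of the problem is $$\pi_k^*(u|x)=\mathcal N\Big(u\,\Big|\,-\Lambda_k^{-1}B_k^\top Q_{-,k+1}^{-1}A_k(x-\mu_k^*)+\bar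 u_k^*,\ \varepsilon\Lambda_k^{-1}\Big),\qquad 0\le k\le N-1,$$ where $\mathcal N(\cdot|c,C)$ is the density of the Gaussian distribution with mean $c$ and covariance matrix $C$. That is, $\pi^*$ satisfies the constraints, its cost is at most that of every feasible policy (even one started from another law of $x_0$ with the same mean and covariance), and any feasible policy $\pi$ whose cost does not exceed that of $\pi^*$ satisfies, for every $k$, $\pi_k(\cdot|x)=\pi_k^*(\cdot|x)$ Lebesgue-almost everywhere for almost every $x$ with respect to the law of $x_k$ under $\pi$. -/

import Mathlib

open MeasureTheory Matrix

namespace MaxEntSteering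

/-! Vectors of `ℝ^d` are functions `Fin d → ℝ`; Euclidean lengths are written with the dot product
`v ⬝ᵥ v`, and `volume` is Lebesgue measure. Time-dependent objects are families over `ℕ`, of which
only the indices of the horizon `0, …, N` play a role. -/

section LinearSystem

variable {n m : ℕ}

/-- `forwardProd A l j = A_{l+j-1} ⋯ A_{l+1} A_l`. -/
def forwardProd (A : ℕ → Matrix (Fin n) (Fin n) ℝ) (l : ℕ) : ℕ → Matrix (Fin n) (Fin n) ℝ
  | 0 => 1
  | j + 1 => A (l + j) * forwardProd A l j

/-- `backwardProd A k j = A_k⁻¹ A_{k+1}⁻¹ ⋯ A_{k+j-1}⁻¹`. -/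
noncomputable def backwardProd (A : ℕ → Matrix (Fin n) (Fin n) ℝ) (k : ℕ) :
    ℕ → Matrix (Fin n) (Fin n) ℝ
  | 0 => 1
  | j + 1 => backwardProd A k j * (A (k + j))⁻¹

/-- The state-transition matrix `Φ(k, l)`. -/
noncomputable def transition (A : ℕ → Matrix (Fin n) (Fin n) ℝ) (k l : ℕ) :
    Matrix (Fin n) (Fin n) ℝ :=
  if l ≤ k then forwardProd A l (k - l) else backwardProd A k (l - k)

/-- The reachability Gramian `G_r(k₁, k₀)`. -/
noncomputable def reachGramian (A : ℕ → Matrix (Fin n) (Fin n) ℝ)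
    (B : ℕ → Matrix (Fin n) (Fin m) ℝ) (k₁ k₀ : ℕ) : Matrix (Fin n) (Fin n) ℝ :=
  ∑ k ∈ Finset.Ico k₀ k₁,
    transition A k₁ (k + 1) * B k * (B k)ᵀ * (transition A k₁ (k + 1))ᵀ

/-- The controllability Gramian `G_c(k₁, k₀)`. -/
noncomputable def ctrlGramian (A : ℕ → Matrix (Fin n) (Fin n) ℝ)
    (B : ℕ → Matrix (Fin n) (Fin m) ℝ) (k₁ k₀ : ℕ) : Matrix (Fin n) (Fin n) ℝ :=
  ∑ k ∈ Finset.Ico k₀ k₁,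
    transition A k₀ (k + 1) * B k * (B k)ᵀ * (transition A k₀ (k + 1))ᵀ

open scoped MatrixOrder in
/-- The positive semidefinite square root of a positive semidefinite matrix. -/
noncomputable def msqrt (M : Matrix (Fin n) (Fin n) ℝ) : Matrix (Fin n) (Fin n) ℝ :=
  CFC.sqrt M

/-- `S₀ = ε⁻¹ G_c(N,0)^{-1/2} Σ₀ G_c(N,0)^{-1/2}`. -/
noncomputable def normalizedInit (N : ℕ) (A : ℕ → Matrix (Fin n) (Fin n) ℝ)
    (B : ℕ → Matrix (Fin n) (Fin m) ℝ) (ε : ℝ) (C₀ : Matrix (Fin n) (Fin n) ℝ) :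
    Matrix (Fin n) (Fin n) ℝ :=
  ε⁻¹ • ((msqrt (ctrlGramian A B N 0))⁻¹ * C₀ * (msqrt (ctrlGramian A B N 0))⁻¹)

/-- `S_N = ε⁻¹ G_c(N,0)^{-1/2} Φ(0,N) Σ_N Φ(0,N)ᵀ G_c(N,0)^{-1/2}`. -/
noncomputable def normalizedFinal (N : ℕ) (A : ℕ → Matrix (Fin n) (Fin n) ℝ)
    (B : ℕ → Matrix (Fin n) (Fin m) ℝ) (ε : ℝ) (CN : Matrix (Fin n) (Fin n) ℝ) :
    Matrix (Fin n) (Fin n) ℝ :=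
  ε⁻¹ • ((msqrt (ctrlGramian A B N 0))⁻¹ *
    (transition A 0 N * CN * (transition A 0 N)ᵀ) * (msqrt (ctrlGramian A B N 0))⁻¹)

/-- `(S₀^{1/2} S_N S₀^{1/2} + I/4)^{1/2}`. -/
noncomputable def rootTerm (S₀ SN : Matrix (Fin n) (Fin n) ℝ) : Matrix (Fin n) (Fin n) ℝ :=
  msqrt (msqrt S₀ * SN * msqrt S₀ + (1 / 4 : ℝ) • (1 : Matrix (Fin n) (Fin n) ℝ))

/-- `F(S₀, S_N) = S₀ + I/2 - (S₀^{1/2} S_N S₀^{1/2} + I/4)^{1/2}`. -/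
noncomputable def forwardTerm (S₀ SN : Matrix (Fin n) (Fin n) ℝ) : Matrix (Fin n) (Fin n) ℝ :=
  S₀ + (1 / 2 : ℝ) • (1 : Matrix (Fin n) (Fin n) ℝ) - rootTerm S₀ SN

/-- `B(S₀, S_N) = -S₀ + I/2 + (S₀^{1/2} S_N S₀^{1/2} + I/4)^{1/2}`. -/
noncomputable def backwardTerm (S₀ SN : Matrix (Fin n) (Fin n) ℝ) : Matrix (Fin n) (Fin n) ℝ :=
  -S₀ + (1 / 2 : ℝ) • (1 : Matrix (Fin n) (Fin n) ℝ) + rootTerm S₀ SN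

/-- The initial value
`Q_{-,0} = G_c^{1/2} S₀^{1/2} (S₀ + I/2 - (S₀^{1/2} S_N S₀^{1/2} + I/4)^{1/2})⁻¹ S₀^{1/2} G_c^{1/2}`
with `G_c = G_c(N,0)`. -/
noncomputable def qMinusInit (N : ℕ) (A : ℕ → Matrix (Fin n) (Fin n) ℝ)
    (B : ℕ → Matrix (Fin n) (Fin m) ℝ) (ε : ℝ) (C₀ CN : Matrix (Fin n) (Fin n) ℝ) :
    Matrix (Fin n) (Fin n) ℝ :=
  msqrt (ctrlGramian A B N 0) * msqrt (normalizedInit N A B ε C₀) *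
    (forwardTerm (normalizedInit N A B ε C₀) (normalizedFinal N A B ε CN))⁻¹ *
    msqrt (normalizedInit N A B ε C₀) * msqrt (ctrlGramian A B N 0)

/-- `Q_{-,k}`: the solution of `Q_{k+1} = A_k Q_k A_kᵀ - B_k B_kᵀ` started at `Q_{-,0}`. -/
noncomputable def qMinus (N : ℕ) (A : ℕ → Matrix (Fin n) (Fin n) ℝ)
    (B : ℕ → Matrix (Fin n) (Fin m) ℝ) (ε : ℝ) (C₀ CN : Matrix (Fin n) (Fin n) ℝ) :
    ℕ → Matrix (Fin n) (Fin n) ℝ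
  | 0 => qMinusInit N A B ε C₀ CN
  | k + 1 => A k * qMinus N A B ε C₀ CN k * (A k)ᵀ - B k * (B k)ᵀ

/-- `Λ_k = I + B_kᵀ Q_{-,k+1}⁻¹ B_k`. -/
noncomputable def gainWeight (N : ℕ) (A : ℕ → Matrix (Fin n) (Fin n) ℝ)
    (B : ℕ → Matrix (Fin n) (Fin m) ℝ) (ε : ℝ) (C₀ CN : Matrix (Fin n) (Fin n) ℝ) (k : ℕ) :
    Matrix (Fin m) (Fin m) ℝ :=
  1 + (B k)ᵀ * (qMinus N A B ε C₀ CN (k + 1))⁻¹ * B k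

/-- The mean-steering input `ū*_k = B_kᵀ Φ(N,k+1)ᵀ G_r(N,0)⁻¹ (μ_N - Φ(N,0) μ_0)`. -/
noncomputable def meanInput (N : ℕ) (A : ℕ → Matrix (Fin n) (Fin n) ℝ)
    (B : ℕ → Matrix (Fin n) (Fin m) ℝ) (μ₀ μN : Fin n → ℝ) (k : ℕ) : Fin m → ℝ :=
  ((B k)ᵀ * (transition A N (k + 1))ᵀ * (reachGramian A B N 0)⁻¹) *ᵥ
    (μN - transition A N 0 *ᵥ μ₀)

/-- The mean trajectory `μ*_k = Φ(k,0) μ_0 + ∑_{s<k} Φ(k,s+1) B_s ū*_s`. -/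
noncomputable def meanState (N : ℕ) (A : ℕ → Matrix (Fin n) (Fin n) ℝ)
    (B : ℕ → Matrix (Fin n) (Fin m) ℝ) (μ₀ μN : Fin n → ℝ) (k : ℕ) : Fin n → ℝ :=
  transition A k 0 *ᵥ μ₀ +
    ∑ s ∈ Finset.range k, (transition A k (s + 1) * B s) *ᵥ meanInput N A B μ₀ μN s

/-- The density `N(u | c, C)` of the Gaussian distribution with mean `c` and covariance `C ≻ 0`. -/
noncomputable def gaussianDensity (c : Fin m → ℝ) (C : Matrix (Fin m) (Fin m) ℝ)
    (u : Fin m → ℝ) : ℝ :=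
  (Real.sqrt ((2 * Real.pi) ^ m * C.det))⁻¹ *
    Real.exp (-(1 / 2) * ((u - c) ⬝ᵥ (C⁻¹ *ᵥ (u - c))))

/-- The candidate policy
`π*_k(u|x) = N(u | -Λ_k⁻¹ B_kᵀ Q_{-,k+1}⁻¹ A_k (x - μ*_k) + ū*_k, ε Λ_k⁻¹)`. -/
noncomputable def optPolicy (N : ℕ) (A : ℕ → Matrix (Fin n) (Fin n) ℝ)
    (B : ℕ → Matrix (Fin n) (Fin m) ℝ) (ε : ℝ) (C₀ CN : Matrix (Fin n) (Fin n) ℝ)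
    (μ₀ μN : Fin n → ℝ) (k : ℕ) (x : Fin n → ℝ) (u : Fin m → ℝ) : ℝ :=
  gaussianDensity
    (-(((gainWeight N A B ε C₀ CN k)⁻¹ * (B k)ᵀ * (qMinus N A B ε C₀ CN (k + 1))⁻¹ * A k) *ᵥ
        (x - meanState N A B μ₀ μN k)) + meanInput N A B μ₀ μN k)
    (ε • (gainWeight N A B ε C₀ CN k)⁻¹) u

end LinearSystem

section ControlProblem

variable {n m : ℕ}

/-- `p` is a stochastic policy on the horizon: `p k x` is, for each `k < N` and each state `x`, a
probability density on the control space, and it is jointly measurable in `(x, u)`. -/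
structure IsPolicy (N : ℕ) (p : ℕ → (Fin n → ℝ) → (Fin m → ℝ) → ℝ) : Prop where
  measurable : ∀ k < N, Measurable (fun z : (Fin n → ℝ) × (Fin m → ℝ) => p k z.1 z.2)
  nonneg : ∀ k < N, ∀ x u, 0 ≤ p k x u
  mass_one : ∀ k < N, ∀ x, ∫⁻ u, ENNReal.ofReal (p k x u) = 1

/-- If the state has law `ρ` and, given the state `x`, the control has density `q x`, this is the
joint law of (state, control). -/
noncomputable def stepLaw (ρ : Measure (Fin n → ℝ)) (q : (Fin n → ℝ) → (Fin m → ℝ) → ℝ) :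
    Measure ((Fin n → ℝ) × (Fin m → ℝ)) :=
  (ρ.prod volume).withDensity (fun z => ENNReal.ofReal (q z.1 z.2))

/-- The law of the state `x_k` when `x_0 ∼ ν`, `u_k ∼ p k x` given `x_k = x`, and
`x_{k+1} = A_k x_k + B_k u_k`. -/
noncomputable def stateLaw (A : ℕ → Matrix (Fin n) (Fin n) ℝ) (B : ℕ → Matrix (Fin n) (Fin m) ℝ)
    (ν : Measure (Fin n → ℝ)) (p : ℕ → (Fin n → ℝ) → (Fin m → ℝ) → ℝ) :
    ℕ → Measure (Fin n → ℝ)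
  | 0 => ν
  | k + 1 => (stepLaw (stateLaw A B ν p k) (p k)).map (fun z => A k *ᵥ z.1 + B k *ᵥ z.2)

/-- The joint law of `(x_k, u_k)`. -/
noncomputable def jointLaw (A : ℕ → Matrix (Fin n) (Fin n) ℝ) (B : ℕ → Matrix (Fin n) (Fin m) ℝ)
    (ν : Measure (Fin n → ℝ)) (p : ℕ → (Fin n → ℝ) → (Fin m → ℝ) → ℝ) (k : ℕ) :
    Measure ((Fin n → ℝ) × (Fin m → ℝ)) :=
  stepLaw (stateLaw A B ν p k) (p k)

/-- The integral of an extended-real function: integral of the positive part minus integral of the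
negative part. -/
noncomputable def extIntegral {α : Type*} [MeasurableSpace α] (ρ : Measure α) (f : α → EReal) :
    EReal :=
  ((∫⁻ a, (f a).toENNReal ∂ρ : ENNReal) : EReal) - ((∫⁻ a, (-f a).toENNReal ∂ρ : ENNReal) : EReal)

/-- The differential entropy `H(q) = -∫ q log q` of a density, as an extended real. -/
noncomputable def entropy (q : (Fin m → ℝ) → ℝ) : EReal :=
  extIntegral volume (fun u => ((-(q u * Real.log (q u)) : ℝ) : EReal))

/-- The control energy `E[‖u_k‖²]`. -/
noncomputable def energy (A : ℕ → Matrix (Fin n) (Fin n) ℝ) (B : ℕ → Matrix (Fin n) (Fin m) ℝ)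
    (ν : Measure (Fin n → ℝ)) (p : ℕ → (Fin n → ℝ) → (Fin m → ℝ) → ℝ) (k : ℕ) : ENNReal :=
  ∫⁻ z, ENNReal.ofReal (z.2 ⬝ᵥ z.2) ∂(jointLaw A B ν p k)

/-- The expected entropy `E[H(p_k(·|x_k))]`. -/
noncomputable def expectedEntropy (A : ℕ → Matrix (Fin n) (Fin n) ℝ)
    (B : ℕ → Matrix (Fin n) (Fin m) ℝ) (ν : Measure (Fin n → ℝ))
    (p : ℕ → (Fin n → ℝ) → (Fin m → ℝ) → ℝ) (k : ℕ) : EReal :=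
  extIntegral (stateLaw A B ν p k) (fun x => entropy (p k x))

open scoped Classical in
/-- The cost `E[∑_{k<N} (‖u_k‖²/2 - ε H(p_k(·|x_k)))]`, with values in `(-∞, ∞]`.
When every `E[‖u_k‖²]` is finite, almost every `p_k(·|x_k)` has finite second moment, its entropy
is defined in `[-∞, ∞)`, and the positive part of that entropy is integrable, so that each summand
below is defined without any `∞ - ∞`. When some `E[‖u_k‖²]` is infinite the cost is `∞`: the
entropy of a density grows only logarithmically with its second moment, so it cannot compensate
for an infinite energy. -/
noncomputable def cost (N : ℕ) (A : ℕ → Matrix (Fin n) (Fin n) ℝ)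
    (B : ℕ → Matrix (Fin n) (Fin m) ℝ) (ε : ℝ) (ν : Measure (Fin n → ℝ))
    (p : ℕ → (Fin n → ℝ) → (Fin m → ℝ) → ℝ) : EReal :=
  if ∀ k < N, energy A B ν p k ≠ ⊤ then
    ∑ k ∈ Finset.range N,
      (((energy A B ν p k / 2 : ENNReal) : EReal) - (ε : EReal) * expectedEntropy A B ν p k)
  else ⊤

/-- `ρ` has finite second moment, mean `c` and covariance matrix `C`. -/
structure HasMeanCov (ρ : Measure (Fin n → ℝ)) (c : Fin n → ℝ) (C : Matrix (Fin n) (Fin n) ℝ) :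
    Prop where
  memLp : ∀ i, MemLp (fun x : Fin n → ℝ => x i) 2 ρ
  mean : ∀ i, ∫ x, x i ∂ρ = c i
  cov : ∀ i j, ∫ x, (x i - c i) * (x j - c j) ∂ρ = C i j

/-- The initial law `ν` and the policy `p` satisfy all constraints of the problem with prescribed
mean and covariance of `x_0` and of `x_N`. -/
structure IsFeasible (N : ℕ) (A : ℕ → Matrix (Fin n) (Fin n) ℝ) (B : ℕ → Matrix (Fin n) (Fin m) ℝ)
    (μ₀ μN : Fin n → ℝ) (C₀ CN : Matrix (Fin n) (Fin n) ℝ)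
    (ν : Measure (Fin n → ℝ)) (p : ℕ → (Fin n → ℝ) → (Fin m → ℝ) → ℝ) : Prop where
  prob : IsProbabilityMeasure ν
  policy : IsPolicy N p
  initial : HasMeanCov ν μ₀ C₀
  final : HasMeanCov (stateLaw A B ν p N) μN CN

end ControlProblem

end MaxEntSteering

namespace MaxEntSteering

/-! ### Quadratic-form inequalities and positive square roots. -/

section MatrixInequalities

variable {n m : ℕ}

/-! The proof is a verification argument resting on one exact formula: for a feasible policy `p` of
finite energy, the cost equals a constant fixed by the data plus `ε` times the sum over `k` of the
expected relative entropies of `p k x` with respect to the candidate policy (`cost_eq`). Relative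
entropy is nonnegative and vanishes only when the densities agree almost everywhere, so optimality
and uniqueness both follow. Infinite energy means infinite cost.

The formula arises by writing entropy as cross entropy minus relative entropy (`entropy_eq`,
`extIntegral_entropy`). What remains of the stage cost is the expectation of `‖u‖²/2 + ε log
π*(u|x)`. Completing squares with the Riccati solution `Q_k⁻¹` (`completion_of_squares`,
`runningCost_eq`) turns this function into a constant, plus a linear term `ū*_k · u`, plus half the
difference of the quadratic forms `(x - μ*_k)ᵀ Q_k⁻¹ (x - μ*_k)` at times `k` and `k + 1`. The
quadratic forms telescope; their end values depend only on the prescribed means and covariances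
(`HasMeanCov.integral_quad`). The linear terms sum to a quantity depending only on the prescribed
means, because the expected state obeys the same linear dynamics (`sum_meanInput_dotProduct`). No
Gaussianity of the competing laws is needed.

Two matters remain. The matrices `Q_k` need not be definite, so their invertibility has to be
argued. Pulled back to time `0`, `Q_k` becomes `Q_0 - G_c(k,0)`, where `0 ≤ G_c(k,0) ≤ G`, and the
choice of `Q_0` gives `Q_0⁻¹ < G⁻¹` (`inv_qMinusInit_lt`). This strict inequality excludes
singularity (`isUnit_sub_of_inv_lt`) and makes every `Λ_k` positive definite
(`posDef_one_add_of_inv_lt`).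

The candidate must also meet the terminal constraints. The closed-loop matrix is `Q_{k+1} A_k⁻ᵀ
Q_k⁻¹` (`closedLoop_eq`), so `Q_k⁻¹ Σ_k Q_k⁻¹ - ε Q_k⁻¹` evolves by congruence with `A_k⁻¹`
(`closedLoop_cov_step`). The terminal covariance is thereby explicit in `Q_0`, and the identity `(R
- 1/2)² + (R - 1/2) = S₀^{1/2} S_N S₀^{1/2}` shows that it is the prescribed one
(`terminal_identity`). -/

theorem dotProduct_mulVec_comm {M : Matrix (Fin n) (Fin n) ℝ} (hM : Mᵀ = M) (x y : Fin n → ℝ) :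
    x ⬝ᵥ (M *ᵥ y) = y ⬝ᵥ (M *ᵥ x) := by
  rw [dotProduct_mulVec, ← mulVec_transpose, hM, dotProduct_comm]

theorem dotProduct_mulVec_transpose (b : Matrix (Fin n) (Fin m) ℝ) (x : Fin n → ℝ)
    (w : Fin m → ℝ) : (bᵀ *ᵥ x) ⬝ᵥ w = x ⬝ᵥ (b *ᵥ w) := by
  rw [dotProduct_mulVec, ← mulVec_transpose]

theorem PosDef_transpose_eq {M : Matrix (Fin n) (Fin n) ℝ} (hM : M.PosDef) : Mᵀ = M := by
  simpa [conjTranspose_eq_transpose_of_trivial] using hM.isHermitian.eq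

theorem PosSemidef_transpose_eq {M : Matrix (Fin n) (Fin n) ℝ} (hM : M.PosSemidef) : Mᵀ = M := by
  simpa [conjTranspose_eq_transpose_of_trivial] using hM.isHermitian.eq

theorem isHermitian_of_transpose_eq {M : Matrix (Fin n) (Fin n) ℝ} (hM : Mᵀ = M) :
    M.IsHermitian := by
  rw [IsHermitian, conjTranspose_eq_transpose_of_trivial, hM]

theorem PosSemidef_quad_nonneg {M : Matrix (Fin n) (Fin n) ℝ} (hM : M.PosSemidef)
    (x : Fin n → ℝ) : 0 ≤ x ⬝ᵥ (M *ᵥ x) := by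
  simpa using hM.dotProduct_mulVec_nonneg x

theorem PosDef_quad_pos {M : Matrix (Fin n) (Fin n) ℝ} (hM : M.PosDef)
    {x : Fin n → ℝ} (hx : x ≠ 0) : 0 < x ⬝ᵥ (M *ᵥ x) := by
  simpa using hM.dotProduct_mulVec_pos hx

theorem posDef_of_quad_pos {M : Matrix (Fin n) (Fin n) ℝ} (hM : Mᵀ = M)
    (h : ∀ x, x ≠ 0 → 0 < x ⬝ᵥ (M *ᵥ x)) : M.PosDef :=
  PosDef.of_dotProduct_mulVec_pos (isHermitian_of_transpose_eq hM) (by simpa using h)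

theorem PosDef_conj {M : Matrix (Fin n) (Fin n) ℝ} (hM : M.PosDef)
    {b : Matrix (Fin n) (Fin n) ℝ} (hb : IsUnit b) : (b * M * bᵀ).PosDef := by
  have := (hb.posDef_star_right_conjugate_iff (x := M)).2 hM
  simpa [star_eq_conjTranspose, conjTranspose_eq_transpose_of_trivial] using this

theorem posSemidef_mul_transpose (b : Matrix (Fin n) (Fin m) ℝ) : (b * bᵀ).PosSemidef := by
  simpa [conjTranspose_eq_transpose_of_trivial] using posSemidef_self_mul_conjTranspose b

/-- If `E + b bᵀ ≤ G`, then `[E, b]` is a contraction from the seminorm of `E ⊕ 1` to the norm of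
`G⁻¹`. -/
theorem inv_quad_le_of_add_le {G E : Matrix (Fin n) (Fin n) ℝ} {b : Matrix (Fin n) (Fin m) ℝ}
    (hG : G.PosDef) (hE : E.PosSemidef) (hle : (G - (E + b * bᵀ)).PosSemidef)
    (x : Fin n → ℝ) (w : Fin m → ℝ) :
    (E *ᵥ x + b *ᵥ w) ⬝ᵥ (G⁻¹ *ᵥ (E *ᵥ x + b *ᵥ w)) ≤ x ⬝ᵥ (E *ᵥ x) + w ⬝ᵥ w := by
  -- With this `v`, the right side minus the left side is the sum of three nonnegative terms: the
  -- `E`-form at `x - v`, the form of `G - (E + b bᵀ)` at `v`, and `‖w - bᵀ v‖²`.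
  set v := G⁻¹ *ᵥ (E *ᵥ x + b *ᵥ w) with hv
  have hGv : G *ᵥ v = E *ᵥ x + b *ᵥ w := by
    rw [hv, mulVec_mulVec, mul_nonsing_inv _ ((isUnit_iff_isUnit_det _).1 hG.isUnit), one_mulVec]
  have h1 := PosSemidef_quad_nonneg hE (x - v)
  have h2 := PosSemidef_quad_nonneg hle v
  have h3 : 0 ≤ (w - bᵀ *ᵥ v) ⬝ᵥ (w - bᵀ *ᵥ v) := by
    simpa using dotProduct_star_self_nonneg (w - bᵀ *ᵥ v)
  have h4 : (E *ᵥ x + b *ᵥ w) ⬝ᵥ v = v ⬝ᵥ (E *ᵥ x) + v ⬝ᵥ (b *ᵥ w) := by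
    rw [dotProduct_comm, dotProduct_add]
  have h5 : v ⬝ᵥ (G *ᵥ v) = v ⬝ᵥ (E *ᵥ x) + v ⬝ᵥ (b *ᵥ w) := by rw [hGv, dotProduct_add]
  have hs := dotProduct_mulVec_comm (PosSemidef_transpose_eq hE) x v
  have h6 : w ⬝ᵥ (bᵀ *ᵥ v) = v ⬝ᵥ (b *ᵥ w) := by
    rw [dotProduct_comm, dotProduct_mulVec_transpose]
  have h7 : (bᵀ *ᵥ v) ⬝ᵥ w = v ⬝ᵥ (b *ᵥ w) := dotProduct_mulVec_transpose _ _ _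
  have h8 : (bᵀ *ᵥ v) ⬝ᵥ (bᵀ *ᵥ v) = v ⬝ᵥ ((b * bᵀ) *ᵥ v) := by
    rw [dotProduct_mulVec_transpose, mulVec_mulVec]
  simp only [mulVec_sub, sub_dotProduct, dotProduct_sub, sub_mulVec, add_mulVec,
    dotProduct_add] at h1 h2 h3
  linarith

/-- A matrix with `Q⁻¹ < G⁻¹` has no generalized eigenvalue in `[0, G]`. -/
theorem isUnit_sub_of_inv_lt {G Q E : Matrix (Fin n) (Fin n) ℝ} (hG : G.PosDef) (hQ : IsUnit Q)
    (hlt : (G⁻¹ - Q⁻¹).PosDef) (hE : E.PosSemidef)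
    (hle : (G - E).PosSemidef) : IsUnit (Q - E) := by
  rw [isUnit_iff_isUnit_det, isUnit_iff_ne_zero]
  intro h0
  obtain ⟨x, hx, hx0⟩ := exists_mulVec_eq_zero_iff.2 h0
  rw [sub_mulVec, sub_eq_zero] at hx0
  have hxy : Q⁻¹ *ᵥ (Q *ᵥ x) = x := by
    rw [mulVec_mulVec, nonsing_inv_mul _ ((isUnit_iff_isUnit_det _).1 hQ), one_mulVec]
  have hy : Q *ᵥ x ≠ 0 := by
    intro h
    rw [h, mulVec_zero] at hxy
    exact hx hxy.symm
  have h1 := PosDef_quad_pos hlt hy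
  rw [sub_mulVec, dotProduct_sub, hxy] at h1
  -- A matrix with no columns removes the `b` part. For `y = Q x = E x` this gives `yᵀ G⁻¹ y ≤ xᵀ
  -- y`, while `h1` says `yᵀ G⁻¹ y > yᵀ Q⁻¹ y = xᵀ y`.
  have h2 := inv_quad_le_of_add_le (b := (0 : Matrix (Fin n) (Fin 0) ℝ)) hG hE (by simpa using hle)
    x 0
  simp only [zero_mulVec, add_zero, dotProduct_zero, ← hx0] at h2
  rw [dotProduct_comm (Q *ᵥ x) x] at h1
  linarith

/-- Put `x = (Q - E - b bᵀ)⁻¹ b u`, so that the form at `u` is `‖u‖² + x · b u` and `Q x = E x + b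
(bᵀ x + u)`. If `x ≠ 0`, then `x · Q x < (Q x)ᵀ G⁻¹ (Q x) ≤ x · E x + ‖bᵀ x + u‖²`; expanding both
ends leaves exactly `0 < ‖u‖² + x · b u`. -/
theorem posDef_one_add_of_inv_lt {G Q E : Matrix (Fin n) (Fin n) ℝ} {b : Matrix (Fin n) (Fin m) ℝ}
    (hG : G.PosDef) (hQ : IsUnit Q)
    (hQs : Qᵀ = Q) (hlt : (G⁻¹ - Q⁻¹).PosDef) (hE : E.PosSemidef)
    (hle : (G - (E + b * bᵀ)).PosSemidef) :
    (1 + bᵀ * (Q - (E + b * bᵀ))⁻¹ * b).PosDef := by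
  have hE' : (E + b * bᵀ).PosSemidef := hE.add (posSemidef_mul_transpose b)
  have hU := isUnit_sub_of_inv_lt hG hQ hlt hE' hle
  have hsym : (Q - (E + b * bᵀ))ᵀ = Q - (E + b * bᵀ) := by
    rw [transpose_sub, hQs, PosSemidef_transpose_eq hE']
  refine posDef_of_quad_pos ?_ fun u hu => ?_
  · simp only [transpose_add, transpose_mul, transpose_one, transpose_transpose,
      transpose_nonsing_inv, hsym, Matrix.mul_assoc]
  set x := (Q - (E + b * bᵀ))⁻¹ *ᵥ (b *ᵥ u) with hx
  have hquad : u ⬝ᵥ ((1 + bᵀ * (Q - (E + b * bᵀ))⁻¹ * b) *ᵥ u) = u ⬝ᵥ u + x ⬝ᵥ (b *ᵥ u) := by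
    rw [add_mulVec, one_mulVec, dotProduct_add, Matrix.mul_assoc, ← mulVec_mulVec, ← mulVec_mulVec, ← hx,
      dotProduct_comm u (bᵀ *ᵥ x), dotProduct_mulVec_transpose]
  have hsol : Q *ᵥ x = E *ᵥ x + b *ᵥ (bᵀ *ᵥ x + u) := by
    have : (Q - (E + b * bᵀ)) *ᵥ x = b *ᵥ u := by
      rw [hx, mulVec_mulVec, mul_nonsing_inv _ ((isUnit_iff_isUnit_det _).1 hU), one_mulVec]
    rw [sub_mulVec, add_mulVec, ← mulVec_mulVec, sub_eq_iff_eq_add] at this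
    rw [this, mulVec_add]
    abel
  have hxy : Q⁻¹ *ᵥ (Q *ᵥ x) = x := by
    rw [mulVec_mulVec, nonsing_inv_mul _ ((isUnit_iff_isUnit_det _).1 hQ), one_mulVec]
  have huu : 0 < u ⬝ᵥ u := by
    simpa using PosDef_quad_pos (PosDef.one (n := Fin m) (R := ℝ)) hu
  rw [hquad]
  by_cases hx0 : x = 0
  · rw [hx0, zero_dotProduct, add_zero]
    exact huu
  have hy : Q *ᵥ x ≠ 0 := by
    intro h
    rw [h, mulVec_zero] at hxy
    exact hx0 hxy.symm
  have h1 := PosDef_quad_pos hlt hy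
  rw [sub_mulVec, dotProduct_sub, hxy, dotProduct_comm (Q *ᵥ x) x] at h1
  have h2 := inv_quad_le_of_add_le hG hE hle x (bᵀ *ᵥ x + u)
  rw [← hsol] at h2
  have h3 : x ⬝ᵥ (Q *ᵥ x) = x ⬝ᵥ (E *ᵥ x) + (bᵀ *ᵥ x) ⬝ᵥ (bᵀ *ᵥ x) + x ⬝ᵥ (b *ᵥ u) := by
    rw [hsol, mulVec_add, dotProduct_add, dotProduct_add, dotProduct_mulVec_transpose, add_assoc]
  have h4 : (bᵀ *ᵥ x + u) ⬝ᵥ (bᵀ *ᵥ x + u)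
      = (bᵀ *ᵥ x) ⬝ᵥ (bᵀ *ᵥ x) + 2 * (x ⬝ᵥ (b *ᵥ u)) + u ⬝ᵥ u := by
    rw [add_dotProduct, dotProduct_add, dotProduct_add, dotProduct_comm u (bᵀ *ᵥ x),
      dotProduct_mulVec_transpose b x u]
    ring
  linarith

open scoped MatrixOrder in
theorem msqrt_posSemidef (M : Matrix (Fin n) (Fin n) ℝ) : (msqrt M).PosSemidef :=
  nonneg_iff_posSemidef.1 (CFC.sqrt_nonneg M)

open scoped MatrixOrder in
theorem msqrt_mul_self {M : Matrix (Fin n) (Fin n) ℝ} (hM : M.PosSemidef) :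
    msqrt M * msqrt M = M :=
  CFC.sqrt_mul_sqrt_self M hM.nonneg

theorem msqrt_transpose (M : Matrix (Fin n) (Fin n) ℝ) : (msqrt M)ᵀ = msqrt M :=
  PosSemidef_transpose_eq (msqrt_posSemidef M)

theorem msqrt_isUnit {M : Matrix (Fin n) (Fin n) ℝ} (hM : M.PosDef) : IsUnit (msqrt M) := by
  have h := hM.isUnit
  rw [isUnit_iff_isUnit_det] at h ⊢
  rw [← msqrt_mul_self hM.posSemidef, det_mul] at h
  exact isUnit_of_mul_isUnit_left h

/-- `(M + I/4)^{1/2} > I/2` for positive definite `M`. -/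
theorem msqrt_add_quarter_sub_half_posDef {M : Matrix (Fin n) (Fin n) ℝ} (hM : M.PosDef) :
    (msqrt (M + (1 / 4 : ℝ) • 1) - (1 / 2 : ℝ) • 1).PosDef := by
  set R := msqrt (M + (1 / 4 : ℝ) • 1) with hR
  have hR2 : R * R = M + (1 / 4 : ℝ) • 1 :=
    msqrt_mul_self (hM.posSemidef.add (PosSemidef.one.smul (by norm_num)))
  have hH : (R - (1 / 2 : ℝ) • 1).IsHermitian := by
    apply isHermitian_of_transpose_eq
    rw [transpose_sub, transpose_smul, transpose_one, msqrt_transpose]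
  rw [hH.posDef_iff_eigenvalues_pos]
  intro i
  set v : Fin n → ℝ := (hH.eigenvectorBasis i).ofLp with hv
  set c := hH.eigenvalues i with hc
  have hv0 : v ≠ 0 := by
    intro h
    have := hH.eigenvectorBasis.orthonormal.ne_zero i
    apply this
    ext j
    exact congrFun h j
  have he : (R - (1 / 2 : ℝ) • 1) *ᵥ v = c • v := hH.mulVec_eigenvectorBasis i
  have hRv : R *ᵥ v = (c + 1 / 2) • v := by
    rw [sub_mulVec, smul_mulVec, one_mulVec, sub_eq_iff_eq_add] at he
    rw [he, add_smul]
  have hMv : M *ᵥ v = ((c + 1 / 2) ^ 2 - 1 / 4) • v := by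
    have : (R * R) *ᵥ v = (c + 1 / 2) ^ 2 • v := by
      rw [← mulVec_mulVec, hRv, mulVec_smul, hRv, smul_smul, sq]
    rw [hR2, add_mulVec, smul_mulVec, one_mulVec] at this
    rw [sub_smul, ← this, add_sub_cancel_right]
  have hvv : 0 < v ⬝ᵥ v := by simpa using PosDef_quad_pos (PosDef.one (n := Fin n) (R := ℝ)) hv0
  have h1 := PosDef_quad_pos hM hv0
  have h2 := PosSemidef_quad_nonneg (msqrt_posSemidef (M + (1 / 4 : ℝ) • 1)) v
  rw [hMv, dotProduct_smul, smul_eq_mul] at h1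
  rw [← hR, hRv, dotProduct_smul, smul_eq_mul] at h2
  -- An eigenvalue `c` of `R - 1/2` satisfies `c (c + 1) > 0`, since it gives an eigenvalue of `M`,
  -- and `c + 1/2 ≥ 0`, since `R` is positive semidefinite. Hence `c > 0`.
  have h3 := pos_of_mul_pos_left h1 hvv.le
  have h4 : 0 ≤ c + 1 / 2 := nonneg_of_mul_nonneg_left h2 hvv
  nlinarith

end MatrixInequalities

/-! ### Algebra of one Riccati step and of the terminal condition. -/

section RiccatiStep

variable {n m : ℕ}

/-- The ring identity behind the terminal covariance condition. -/
theorem terminal_identity {s si g gi F Fi R SN : Matrix (Fin n) (Fin n) ℝ} {ε : ℝ}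
    (hs : s * si = 1) (hs' : si * s = 1) (hg : g * gi = 1) (hg' : gi * g = 1)
    (hF : F * Fi = 1) (hF' : Fi * F = 1)
    (hR : R * R = s * SN * s + (1 / 4 : ℝ) • 1) (hFR : F = s * s + (1 / 2 : ℝ) • 1 - R)
    {Q Qi C X : Matrix (Fin n) (Fin n) ℝ} (hQ : Q = g * s * Fi * s * g)
    (hQi : Qi = gi * si * F * si * gi) (hC : C = ε • (g * s * s * g))
    (hX : X = Qi * C * Qi - ε • Qi) :
    (Q - g * g) * X * (Q - g * g) + ε • (Q - g * g) = ε • (g * SN * g) := by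
  have a1 (x : Matrix (Fin n) (Fin n) ℝ) : s * (si * x) = x := by
    rw [← Matrix.mul_assoc, hs, Matrix.one_mul]
  have a2 (x : Matrix (Fin n) (Fin n) ℝ) : si * (s * x) = x := by
    rw [← Matrix.mul_assoc, hs', Matrix.one_mul]
  have a3 (x : Matrix (Fin n) (Fin n) ℝ) : g * (gi * x) = x := by
    rw [← Matrix.mul_assoc, hg, Matrix.one_mul]
  have a4 (x : Matrix (Fin n) (Fin n) ℝ) : gi * (g * x) = x := by
    rw [← Matrix.mul_assoc, hg', Matrix.one_mul]
  have a5 (x : Matrix (Fin n) (Fin n) ℝ) : F * (Fi * x) = x := by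
    rw [← Matrix.mul_assoc, hF, Matrix.one_mul]
  have a6 (x : Matrix (Fin n) (Fin n) ℝ) : Fi * (F * x) = x := by
    rw [← Matrix.mul_assoc, hF', Matrix.one_mul]
  have hQQi : Q * Qi = 1 := by
    rw [hQ, hQi]; simp only [Matrix.mul_assoc, a1, a3, a6, hg]
  have hQiQ : Qi * Q = 1 := by
    rw [hQ, hQi]; simp only [Matrix.mul_assoc, a2, a4, a5, hg']
  -- The shift by one half absorbs the quarter: `T² + T = R² - 1/4`. Since also `F = s² - T`, the
  -- factor `(Q - g²) Q⁻¹ = 1 - g² Q⁻¹` is conjugate to `T` plain and simple. The left side of the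
  -- goal then collapses to `ε g s⁻¹ (T² + T) s⁻¹ g`.
  set T := R - (1 / 2 : ℝ) • (1 : Matrix (Fin n) (Fin n) ℝ) with hT
  have hFT : F = s * s - T := by rw [hFR, hT]; abel
  have hJ : (Q - g * g) * Qi = g * si * T * si * gi := by
    rw [Matrix.sub_mul, hQQi, hQi, hFT]
    simp only [Matrix.mul_assoc, Matrix.mul_sub, Matrix.sub_mul, a1, a2, a3, hg]
    abel
  have hJt : Qi * (Q - g * g) = gi * si * T * si * g := by
    rw [Matrix.mul_sub, hQiQ, hQi, hFT]
    simp only [Matrix.mul_assoc, Matrix.mul_sub, Matrix.sub_mul, a1, a2, a4, hg']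
    abel
  have hTT : T * T + T = s * SN * s := by
    rw [hT]
    simp only [Matrix.mul_sub, Matrix.sub_mul, hR, Matrix.smul_mul, Matrix.mul_smul,
      Matrix.one_mul, Matrix.mul_one]
    module
  have e1 : (Q - g * g) * X * (Q - g * g)
      = ((Q - g * g) * Qi) * C * (Qi * (Q - g * g)) - ε • ((Q - g * g) * (Qi * (Q - g * g))) := by
    rw [hX]
    generalize Q - g * g = D
    simp only [Matrix.mul_sub, Matrix.sub_mul, Matrix.mul_smul, Matrix.smul_mul, Matrix.mul_assoc]
  have e2 : (Q - g * g) * (Qi * (Q - g * g)) = (Q - g * g) - g * si * T * si * g := by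
    rw [← Matrix.mul_assoc, hJ, Matrix.mul_sub, ← hJ, Matrix.mul_assoc, hQiQ, Matrix.mul_one, hJ]
    simp only [Matrix.mul_assoc, a4]
  rw [e1, e2, hJ, hJt, hC]
  have e3 : g * si * T * si * gi * ε • (g * s * s * g) * (gi * si * T * si * g)
      = ε • (g * si * (T * T) * si * g) := by
    simp only [Matrix.mul_smul, Matrix.smul_mul, Matrix.mul_assoc, a1, a2, a3, a4]
  have e4 : g * SN * g = g * si * (T * T + T) * si * g := by
    rw [hTT]
    simp only [Matrix.mul_assoc, a1, a2]
  rw [e3, e4, smul_sub, Matrix.mul_add, Matrix.add_mul, Matrix.add_mul, smul_add]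
  abel

variable {A Q Q' : Matrix (Fin n) (Fin n) ℝ} {B : Matrix (Fin n) (Fin m) ℝ}
  {L : Matrix (Fin m) (Fin m) ℝ} {K : Matrix (Fin m) (Fin n) ℝ}

/-- Since `A Q Aᵀ = Q' + B Bᵀ` and `Bᵀ Q'⁻¹ (Q' + B Bᵀ) = L Bᵀ`, the gain satisfies `K Q Aᵀ = Bᵀ`.
Hence `(A - B K) Q Aᵀ = Q'`, and `Q Aᵀ` can be cancelled. -/
theorem closedLoop_eq (hA : IsUnit A) (hQ : IsUnit Q) (hQ' : IsUnit Q')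
    (hstep : Q' = A * Q * Aᵀ - B * Bᵀ) (hLu : IsUnit L) (hL : L = 1 + Bᵀ * Q'⁻¹ * B)
    (hK : K = L⁻¹ * Bᵀ * Q'⁻¹ * A) : A - B * K = Q' * (A⁻¹)ᵀ * Q⁻¹ := by
  rw [isUnit_iff_isUnit_det] at hA hQ hQ' hLu
  have hAt : IsUnit (Aᵀ).det := by rwa [det_transpose]
  have h1 : A * Q * Aᵀ = Q' + B * Bᵀ := by rw [hstep]; abel
  have h2 : (A - B * K) * (Q * Aᵀ) = Q' := by
    have e : (A - B * K) * (Q * Aᵀ)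
        = A * Q * Aᵀ - B * (L⁻¹ * (Bᵀ * (Q'⁻¹ * (A * Q * Aᵀ)))) := by
      rw [hK]; simp only [Matrix.sub_mul, Matrix.mul_assoc]
    rw [e, h1, Matrix.mul_add, nonsing_inv_mul _ hQ', Matrix.mul_add, Matrix.mul_one]
    have e2 : Bᵀ + Bᵀ * (Q'⁻¹ * (B * Bᵀ)) = L * Bᵀ := by
      rw [hL, Matrix.add_mul, Matrix.one_mul]; simp only [Matrix.mul_assoc]
    rw [e2, nonsing_inv_mul_cancel_left _ _ hLu]
    abel
  calc A - B * K = (A - B * K) * (Q * Aᵀ) * ((Aᵀ)⁻¹ * Q⁻¹) := by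
        rw [Matrix.mul_assoc, Matrix.mul_assoc Q, mul_nonsing_inv_cancel_left _ _ hAt,
          mul_nonsing_inv _ hQ, Matrix.mul_one]
    _ = _ := by rw [h2, transpose_nonsing_inv, Matrix.mul_assoc]

/-- The left side is `B K A⁻¹ Q'`, and `closedLoop_eq` evaluates `B K`. Its negative part cancels
the `ε`-term carried along by the closed loop in `closedLoop_cov_step`. -/
theorem noise_eq (hA : IsUnit A) (hQ : IsUnit Q) (hQ' : IsUnit Q')
    (hstep : Q' = A * Q * Aᵀ - B * Bᵀ) (hLu : IsUnit L) (hL : L = 1 + Bᵀ * Q'⁻¹ * B) :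
    B * L⁻¹ * Bᵀ = Q' - Q' * (A⁻¹)ᵀ * Q⁻¹ * A⁻¹ * Q' := by
  have h := closedLoop_eq hA hQ hQ' hstep hLu hL rfl
  rw [isUnit_iff_isUnit_det] at hA hQ'
  have h2 : B * L⁻¹ * Bᵀ = B * (L⁻¹ * Bᵀ * Q'⁻¹ * A) * A⁻¹ * Q' := by
    simp only [Matrix.mul_assoc, mul_nonsing_inv_cancel_left _ _ hA, nonsing_inv_mul _ hQ',
      Matrix.mul_one]
  rw [h2, ← sub_sub_self A (B * _), h, Matrix.sub_mul, Matrix.sub_mul, mul_nonsing_inv _ hA,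
    Matrix.one_mul]

/-- One step of the closed-loop covariance recursion, in the coordinates in which it is a
congruence. -/
theorem closedLoop_cov_step (hA : IsUnit A) (hQ : IsUnit Q) (hQ' : IsUnit Q') (hQs : Qᵀ = Q)
    (hQs' : Q'ᵀ = Q')
    (hstep : Q' = A * Q * Aᵀ - B * Bᵀ) (hLu : IsUnit L) (hL : L = 1 + Bᵀ * Q'⁻¹ * B)
    (hK : K = L⁻¹ * Bᵀ * Q'⁻¹ * A) (X : Matrix (Fin n) (Fin n) ℝ) (ε : ℝ) :
    (A - B * K) * (Q * X * Q + ε • Q) * (A - B * K)ᵀ + ε • (B * L⁻¹ * Bᵀ)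
      = Q' * ((A⁻¹)ᵀ * X * A⁻¹) * Q' + ε • Q' := by
  rw [closedLoop_eq hA hQ hQ' hstep hLu hL hK, noise_eq hA hQ hQ' hstep hLu hL]
  have hQd := (isUnit_iff_isUnit_det _).1 hQ
  simp only [transpose_mul, transpose_nonsing_inv, transpose_transpose, hQs, hQs', Matrix.mul_add,
    Matrix.add_mul, Matrix.mul_assoc, nonsing_inv_mul_cancel_left _ _ hQd,
    mul_nonsing_inv_cancel_left _ _ hQd, Matrix.smul_mul, Matrix.mul_smul, smul_sub]
  abel

/-- The linear recursion for `Q` is the backward control Riccati equation for `Q⁻¹`. It follows from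
`Kᵀ L = Aᵀ Q'⁻¹ B` and the value of `B K` given by `closedLoop_eq`, without a matrix inversion
lemma. -/
theorem riccati_eq (hA : IsUnit A) (hQ : IsUnit Q) (hQ' : IsUnit Q') (hQs' : Q'ᵀ = Q')
    (hstep : Q' = A * Q * Aᵀ - B * Bᵀ) (hLu : IsUnit L) (hL : L = 1 + Bᵀ * Q'⁻¹ * B)
    (hK : K = L⁻¹ * Bᵀ * Q'⁻¹ * A) : Q⁻¹ + Kᵀ * L * K = Aᵀ * Q'⁻¹ * A := by
  have h := closedLoop_eq hA hQ hQ' hstep hLu hL hK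
  have hLd := (isUnit_iff_isUnit_det _).1 hLu
  have hQd := (isUnit_iff_isUnit_det _).1 hQ'
  have hAd : IsUnit (Aᵀ).det := by rw [det_transpose]; exact (isUnit_iff_isUnit_det _).1 hA
  have hLs : Lᵀ = L := by
    rw [hL]; simp only [transpose_add, transpose_one, transpose_mul, transpose_nonsing_inv, hQs',
      transpose_transpose, Matrix.mul_assoc]
  have h1 : Kᵀ * L = Aᵀ * Q'⁻¹ * B := by
    rw [hK]
    simp only [transpose_mul, transpose_nonsing_inv, hQs', hLs, transpose_transpose,
      Matrix.mul_assoc, nonsing_inv_mul _ hLd, Matrix.mul_one]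
  have h2 : B * K = A - Q' * (A⁻¹)ᵀ * Q⁻¹ := by rw [← h]; abel
  rw [h1, Matrix.mul_assoc _ B K, h2, Matrix.mul_sub, transpose_nonsing_inv]
  simp only [Matrix.mul_assoc, nonsing_inv_mul_cancel_left _ _ hQd,
    mul_nonsing_inv_cancel_left _ _ hAd]
  abel

/-- Completion of squares for one step of the linear-quadratic problem. -/
theorem completion_of_squares (hA : IsUnit A) (hQ : IsUnit Q) (hQ' : IsUnit Q') (hQs' : Q'ᵀ = Q')
    (hstep : Q' = A * Q * Aᵀ - B * Bᵀ) (hLu : IsUnit L) (hL : L = 1 + Bᵀ * Q'⁻¹ * B)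
    (hK : K = L⁻¹ * Bᵀ * Q'⁻¹ * A) (x : Fin n → ℝ) (u : Fin m → ℝ) :
    u ⬝ᵥ u + (A *ᵥ x + B *ᵥ u) ⬝ᵥ (Q'⁻¹ *ᵥ (A *ᵥ x + B *ᵥ u))
      = x ⬝ᵥ (Q⁻¹ *ᵥ x) + (u + K *ᵥ x) ⬝ᵥ (L *ᵥ (u + K *ᵥ x)) := by
  have hric := riccati_eq hA hQ hQ' hQs' hstep hLu hL hK
  have hLd := (isUnit_iff_isUnit_det _).1 hLu
  have hLK : L * K = Bᵀ * Q'⁻¹ * A := by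
    rw [hK]; simp only [Matrix.mul_assoc, mul_nonsing_inv_cancel_left _ _ hLd]
  have hQis : (Q'⁻¹)ᵀ = Q'⁻¹ := by rw [transpose_nonsing_inv, hQs']
  have hLs : Lᵀ = L := by
    rw [hL]; simp only [transpose_add, transpose_one, transpose_mul, transpose_nonsing_inv, hQs',
      transpose_transpose, Matrix.mul_assoc]
  have e1 : (A *ᵥ x) ⬝ᵥ (Q'⁻¹ *ᵥ (A *ᵥ x)) = x ⬝ᵥ (Q⁻¹ *ᵥ x) + (K *ᵥ x) ⬝ᵥ (L *ᵥ (K *ᵥ x)) := by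
    have h1 : x ⬝ᵥ ((Aᵀ * Q'⁻¹ * A) *ᵥ x) = (A *ᵥ x) ⬝ᵥ (Q'⁻¹ *ᵥ (A *ᵥ x)) := by
      rw [Matrix.mul_assoc, ← mulVec_mulVec, ← mulVec_mulVec, ← dotProduct_mulVec_transpose,
        transpose_transpose]
    have h2 : x ⬝ᵥ ((Kᵀ * L * K) *ᵥ x) = (K *ᵥ x) ⬝ᵥ (L *ᵥ (K *ᵥ x)) := by
      rw [Matrix.mul_assoc, ← mulVec_mulVec, ← mulVec_mulVec, ← dotProduct_mulVec_transpose,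
        transpose_transpose]
    rw [← h1, ← h2, ← hric, add_mulVec, dotProduct_add]
  have e2 : u ⬝ᵥ (L *ᵥ (K *ᵥ x)) = (B *ᵥ u) ⬝ᵥ (Q'⁻¹ *ᵥ (A *ᵥ x)) := by
    rw [mulVec_mulVec, hLK, Matrix.mul_assoc, ← mulVec_mulVec, ← mulVec_mulVec,
      ← dotProduct_mulVec_transpose, transpose_transpose]
  have e3 : u ⬝ᵥ (L *ᵥ u) = u ⬝ᵥ u + (B *ᵥ u) ⬝ᵥ (Q'⁻¹ *ᵥ (B *ᵥ u)) := by
    rw [hL, add_mulVec, one_mulVec, dotProduct_add, Matrix.mul_assoc, ← mulVec_mulVec,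
      ← mulVec_mulVec, ← dotProduct_mulVec_transpose, transpose_transpose]
  have e4 := dotProduct_mulVec_comm hQis (A *ᵥ x) (B *ᵥ u)
  have e5 := dotProduct_mulVec_comm hLs u (K *ᵥ x)
  simp only [mulVec_add, dotProduct_add, add_dotProduct]
  linarith

end RiccatiStep

/-! ### Transition matrices and Gramians, pulled back to time zero. -/

section Transition

variable {n m : ℕ} {N : ℕ} {A : ℕ → Matrix (Fin n) (Fin n) ℝ} {B : ℕ → Matrix (Fin n) (Fin m) ℝ}

theorem transition_zero_zero (A : ℕ → Matrix (Fin n) (Fin n) ℝ) : transition A 0 0 = 1 := by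
  simp [transition, forwardProd]

theorem transition_succ_zero (A : ℕ → Matrix (Fin n) (Fin n) ℝ) (k : ℕ) :
    transition A (k + 1) 0 = A k * transition A k 0 := by
  simp [transition, forwardProd]

theorem transition_left_zero (A : ℕ → Matrix (Fin n) (Fin n) ℝ) (k : ℕ) :
    transition A 0 k = backwardProd A 0 k := by
  rcases Nat.eq_zero_or_pos k with rfl | hk
  · simp [transition, forwardProd, backwardProd]
  · simp [transition, Nat.pos_iff_ne_zero.1 hk]

theorem transition_zero_succ (A : ℕ → Matrix (Fin n) (Fin n) ℝ) (k : ℕ) :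
    transition A 0 (k + 1) = transition A 0 k * (A k)⁻¹ := by
  rw [transition_left_zero, transition_left_zero, backwardProd, Nat.zero_add]

theorem transition_mul_inverse (hA : ∀ k < N, IsUnit (A k)) {k : ℕ} (hk : k ≤ N) :
    transition A k 0 * transition A 0 k = 1 := by
  induction k with
  | zero => rw [transition_zero_zero, Matrix.one_mul]
  | succ k ih =>
    have h1 := (isUnit_iff_isUnit_det _).1 (hA k hk)
    rw [transition_succ_zero, transition_zero_succ, Matrix.mul_assoc,
      ← Matrix.mul_assoc (transition A k 0), ih (by omega), Matrix.one_mul, mul_nonsing_inv _ h1]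

/-- Factoring through time `0` lets the later computations work with the two families `Φ(k,0)` and
`Φ(0,k)` alone. -/
theorem transition_eq_mul (hA : ∀ k < N, IsUnit (A k)) {k l : ℕ} (hk : k ≤ N) (hl : l ≤ k) :
    transition A k l = transition A k 0 * transition A 0 l := by
  obtain ⟨j, rfl⟩ := Nat.exists_eq_add_of_le hl
  have h1 : transition A (l + j) l = forwardProd A l j := by simp [transition]
  rw [h1]
  clear h1 hl
  induction j with
  | zero => exact (transition_mul_inverse hA hk).symm
  | succ j ih =>
    rw [forwardProd, ih (by omega), ← Nat.add_assoc, transition_succ_zero, Matrix.mul_assoc]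

theorem ctrlGramian_zero (A : ℕ → Matrix (Fin n) (Fin n) ℝ) (B : ℕ → Matrix (Fin n) (Fin m) ℝ) :
    ctrlGramian A B 0 0 = 0 := by
  simp [ctrlGramian]

theorem ctrlGramian_succ (A : ℕ → Matrix (Fin n) (Fin n) ℝ) (B : ℕ → Matrix (Fin n) (Fin m) ℝ)
    (k : ℕ) : ctrlGramian A B (k + 1) 0 = ctrlGramian A B k 0 +
      (transition A 0 (k + 1) * B k) * (transition A 0 (k + 1) * B k)ᵀ := by
  rw [ctrlGramian, Finset.sum_Ico_succ_top (Nat.zero_le k), ← ctrlGramian, transpose_mul]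
  simp only [Matrix.mul_assoc]

theorem ctrlGramian_sub_posSemidef (A : ℕ → Matrix (Fin n) (Fin n) ℝ)
    (B : ℕ → Matrix (Fin n) (Fin m) ℝ) {k l : ℕ} (h : k ≤ l) :
    (ctrlGramian A B l 0 - ctrlGramian A B k 0).PosSemidef := by
  induction l, h using Nat.le_induction with
  | base => rw [sub_self]; exact PosSemidef.zero
  | succ l h ih =>
    rw [ctrlGramian_succ, add_sub_right_comm]
    exact ih.add (posSemidef_mul_transpose _)

theorem ctrlGramian_posSemidef (A : ℕ → Matrix (Fin n) (Fin n) ℝ)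
    (B : ℕ → Matrix (Fin n) (Fin m) ℝ) (k : ℕ) : (ctrlGramian A B k 0).PosSemidef := by
  simpa [ctrlGramian_zero] using ctrlGramian_sub_posSemidef A B (Nat.zero_le k)

theorem reachGramian_eq (B : ℕ → Matrix (Fin n) (Fin m) ℝ) (hA : ∀ k < N, IsUnit (A k)) :
    reachGramian A B N 0 = transition A N 0 * ctrlGramian A B N 0 * (transition A N 0)ᵀ := by
  rw [reachGramian, ctrlGramian, Finset.mul_sum, Finset.sum_mul]
  refine Finset.sum_congr rfl fun k hk => ?_
  rw [transition_eq_mul hA le_rfl (Finset.mem_Ico.1 hk).2, transpose_mul]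
  simp only [Matrix.mul_assoc]

/-- The reachability Gramian is a congruence of the controllability Gramian, so the latter is
invertible; a positive semidefinite invertible matrix is positive definite. -/
theorem ctrlGramian_posDef (hA : ∀ k < N, IsUnit (A k)) (hG : IsUnit (reachGramian A B N 0)) :
    (ctrlGramian A B N 0).PosDef := by
  rw [reachGramian_eq B hA, isUnit_iff_isUnit_det, det_mul] at hG
  refine (ctrlGramian_posSemidef A B N).posDef_iff_isUnit.2 ?_
  rw [isUnit_iff_isUnit_det]
  have := isUnit_of_mul_isUnit_left hG
  rw [det_mul] at this
  exact isUnit_of_mul_isUnit_right this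

end Transition

/-! ### Invertibility of the Riccati trajectory and the closed-loop covariance. -/

section RiccatiTrajectory

variable {n m : ℕ} {N : ℕ} {A : ℕ → Matrix (Fin n) (Fin n) ℝ} {B : ℕ → Matrix (Fin n) (Fin m) ℝ}
  {ε : ℝ} {C₀ CN : Matrix (Fin n) (Fin n) ℝ}

theorem transition_inverse_mul (hA : ∀ k < N, IsUnit (A k)) {k : ℕ} (hk : k ≤ N) :
    transition A 0 k * transition A k 0 = 1 :=
  mul_eq_one_comm.1 (transition_mul_inverse hA hk)

theorem transition_isUnit (hA : ∀ k < N, IsUnit (A k)) {k : ℕ} (hk : k ≤ N) :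
    IsUnit (transition A k 0) :=
  ⟨⟨_, _, transition_mul_inverse hA hk, transition_inverse_mul hA hk⟩, rfl⟩

theorem transition_isUnit' (hA : ∀ k < N, IsUnit (A k)) {k : ℕ} (hk : k ≤ N) :
    IsUnit (transition A 0 k) :=
  ⟨⟨_, _, transition_inverse_mul hA hk, transition_mul_inverse hA hk⟩, rfl⟩

theorem inv_transpose_eq {M : Matrix (Fin n) (Fin n) ℝ} (hM : Mᵀ = M) : (M⁻¹)ᵀ = M⁻¹ := by
  rw [transpose_nonsing_inv, hM]

theorem posDef_inv_conj {g M : Matrix (Fin n) (Fin n) ℝ} (hM : M.PosDef) (hg : IsUnit g)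
    (hgs : gᵀ = g) : (g⁻¹ * M * g⁻¹).PosDef := by
  have h : IsUnit g⁻¹ := by
    rw [isUnit_iff_isUnit_det] at hg ⊢
    exact isUnit_nonsing_inv_det _ hg
  simpa only [inv_transpose_eq hgs] using PosDef_conj hM h

theorem normalizedInit_posDef (hε : 0 < ε) (hC₀ : C₀.PosDef)
    (hG : (ctrlGramian A B N 0).PosDef) : (normalizedInit N A B ε C₀).PosDef :=
  (posDef_inv_conj hC₀ (msqrt_isUnit hG) (msqrt_transpose _)).smul (inv_pos.2 hε)

theorem normalizedFinal_posDef (hA : ∀ k < N, IsUnit (A k)) (hε : 0 < ε) (hCN : CN.PosDef)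
    (hG : (ctrlGramian A B N 0).PosDef) : (normalizedFinal N A B ε CN).PosDef :=
  (posDef_inv_conj (PosDef_conj hCN (transition_isUnit' hA le_rfl)) (msqrt_isUnit hG)
    (msqrt_transpose _)).smul (inv_pos.2 hε)

theorem rootTerm_transpose (S₀ SN : Matrix (Fin n) (Fin n) ℝ) :
    (rootTerm S₀ SN)ᵀ = rootTerm S₀ SN := msqrt_transpose _

theorem conj_msqrt_posDef {S₀ SN : Matrix (Fin n) (Fin n) ℝ} (h₀ : S₀.PosDef) (hN : SN.PosDef) :
    (msqrt S₀ * SN * msqrt S₀).PosDef := by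
  simpa only [msqrt_transpose] using PosDef_conj hN (msqrt_isUnit h₀)

theorem rootTerm_mul_self {S₀ SN : Matrix (Fin n) (Fin n) ℝ} (h₀ : S₀.PosDef) (hN : SN.PosDef) :
    rootTerm S₀ SN * rootTerm S₀ SN = msqrt S₀ * SN * msqrt S₀ + (1 / 4 : ℝ) • 1 :=
  msqrt_mul_self ((conj_msqrt_posDef h₀ hN).posSemidef.add (PosSemidef.one.smul (by norm_num)))

theorem forwardTerm_transpose {S₀ : Matrix (Fin n) (Fin n) ℝ} (h₀ : S₀.PosDef)
    (SN : Matrix (Fin n) (Fin n) ℝ) : (forwardTerm S₀ SN)ᵀ = forwardTerm S₀ SN := by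
  rw [forwardTerm, transpose_sub, transpose_add, PosDef_transpose_eq h₀, transpose_smul,
    transpose_one, rootTerm_transpose]

theorem qMinusInit_transpose (hε : 0 < ε) (hC₀ : C₀.PosDef)
    (hG : (ctrlGramian A B N 0).PosDef) :
    (qMinusInit N A B ε C₀ CN)ᵀ = qMinusInit N A B ε C₀ CN := by
  simp only [qMinusInit, transpose_mul, msqrt_transpose, transpose_nonsing_inv,
    forwardTerm_transpose (normalizedInit_posDef hε hC₀ hG), Matrix.mul_assoc]

theorem qMinusInit_isUnit (hε : 0 < ε) (hC₀ : C₀.PosDef) (hG : (ctrlGramian A B N 0).PosDef)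
    (hF : IsUnit (forwardTerm (normalizedInit N A B ε C₀) (normalizedFinal N A B ε CN))) :
    IsUnit (qMinusInit N A B ε C₀ CN) := by
  have h1 := msqrt_isUnit hG
  have h2 := msqrt_isUnit (normalizedInit_posDef (A := A) (B := B) (N := N) hε hC₀ hG)
  have h3 := (isUnit_nonsing_inv_iff (A := forwardTerm (normalizedInit N A B ε C₀)
    (normalizedFinal N A B ε CN))).2 hF
  exact (((h1.mul h2).mul h3).mul h2).mul h1

theorem inv_qMinusInit (hF : IsUnit (forwardTerm (normalizedInit N A B ε C₀)
      (normalizedFinal N A B ε CN))) :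
    (qMinusInit N A B ε C₀ CN)⁻¹ =
      (msqrt (ctrlGramian A B N 0))⁻¹ * (msqrt (normalizedInit N A B ε C₀))⁻¹ *
      forwardTerm (normalizedInit N A B ε C₀) (normalizedFinal N A B ε CN) *
      (msqrt (normalizedInit N A B ε C₀))⁻¹ * (msqrt (ctrlGramian A B N 0))⁻¹ := by
  simp only [qMinusInit, Matrix.mul_inv_rev, Matrix.mul_assoc,
    nonsing_inv_nonsing_inv _ ((isUnit_iff_isUnit_det _).1 hF)]

/-- With `g = G^{1/2}` and `s = S₀^{1/2}`, the difference is `g⁻¹ s⁻¹ (S₀ - F) s⁻¹ g⁻¹`, and `S₀ - F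
= R - 1/2` is positive definite by `msqrt_add_quarter_sub_half_posDef`. This inequality, not
definiteness of `Q_0`, keeps the trajectory regular. -/
theorem inv_qMinusInit_lt (hA : ∀ k < N, IsUnit (A k)) (hε : 0 < ε) (hC₀ : C₀.PosDef)
    (hCN : CN.PosDef) (hG : (ctrlGramian A B N 0).PosDef)
    (hF : IsUnit (forwardTerm (normalizedInit N A B ε C₀) (normalizedFinal N A B ε CN))) :
    ((ctrlGramian A B N 0)⁻¹ - (qMinusInit N A B ε C₀ CN)⁻¹).PosDef := by
  have hS₀ := normalizedInit_posDef (A := A) (B := B) (N := N) hε hC₀ hG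
  have hSN := normalizedFinal_posDef (A := A) (B := B) (N := N) hA hε hCN hG
  rw [inv_qMinusInit hF]
  set S₀ := normalizedInit N A B ε C₀
  set SN := normalizedFinal N A B ε CN
  have hs := msqrt_isUnit hS₀
  have hsd := (isUnit_iff_isUnit_det _).1 hs
  have hR := msqrt_add_quarter_sub_half_posDef (conj_msqrt_posDef hS₀ hSN)
  have key := posDef_inv_conj (posDef_inv_conj hR hs (msqrt_transpose S₀)) (msqrt_isUnit hG)
    (msqrt_transpose _)
  convert key using 1
  have e1 : (ctrlGramian A B N 0)⁻¹
      = (msqrt (ctrlGramian A B N 0))⁻¹ * (msqrt (ctrlGramian A B N 0))⁻¹ := by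
    rw [← Matrix.mul_inv_rev, msqrt_mul_self hG.posSemidef]
  have e2 : msqrt (msqrt S₀ * SN * msqrt S₀ + (1 / 4 : ℝ) • 1) - (1 / 2 : ℝ) • 1
      = msqrt S₀ * msqrt S₀ - forwardTerm S₀ SN := by
    rw [msqrt_mul_self hS₀.posSemidef, forwardTerm, rootTerm]; abel
  rw [e1, e2]
  simp only [Matrix.mul_sub, Matrix.sub_mul, Matrix.mul_assoc,
    nonsing_inv_mul_cancel_left _ _ hsd, mul_nonsing_inv_cancel_left _ _ hsd]

/-- In time-zero coordinates the congruence by `A k` disappears, and each step only subtracts the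
next summand of the Gramian. -/
theorem qMinus_eq (hA : ∀ k < N, IsUnit (A k)) {k : ℕ} (hk : k ≤ N) :
    qMinus N A B ε C₀ CN k = transition A k 0 *
      (qMinusInit N A B ε C₀ CN - ctrlGramian A B k 0) * (transition A k 0)ᵀ := by
  induction k with
  | zero => simp [qMinus, ctrlGramian_zero, transition_zero_zero]
  | succ k ih =>
    have h : transition A (k + 1) 0 * (transition A 0 (k + 1) * B k) = B k := by
      rw [← Matrix.mul_assoc, transition_mul_inverse hA hk, Matrix.one_mul]
    have h2 : transition A (k + 1) 0 * ((transition A 0 (k + 1) * B k) *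
        (transition A 0 (k + 1) * B k)ᵀ) * (transition A (k + 1) 0)ᵀ = B k * (B k)ᵀ := by
      rw [← Matrix.mul_assoc, h, Matrix.mul_assoc, ← transpose_mul, h]
    rw [qMinus, ih (by omega), ctrlGramian_succ, ← sub_sub, Matrix.mul_sub _ (_ - _),
      Matrix.sub_mul _ _ (transition A (k + 1) 0)ᵀ, h2, transition_succ_zero, transpose_mul]
    simp only [Matrix.mul_assoc]

theorem qMinus_transpose (hε : 0 < ε) (hC₀ : C₀.PosDef) (hG : (ctrlGramian A B N 0).PosDef)
    (k : ℕ) : (qMinus N A B ε C₀ CN k)ᵀ = qMinus N A B ε C₀ CN k := by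
  induction k with
  | zero => exact qMinusInit_transpose hε hC₀ hG
  | succ k ih =>
    simp only [qMinus, transpose_sub, transpose_mul, transpose_transpose, ih, Matrix.mul_assoc]

theorem qMinus_isUnit (hA : ∀ k < N, IsUnit (A k)) (hε : 0 < ε) (hC₀ : C₀.PosDef)
    (hCN : CN.PosDef) (hG : (ctrlGramian A B N 0).PosDef)
    (hF : IsUnit (forwardTerm (normalizedInit N A B ε C₀) (normalizedFinal N A B ε CN)))
    {k : ℕ} (hk : k ≤ N) : IsUnit (qMinus N A B ε C₀ CN k) := by
  rw [qMinus_eq hA hk]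
  have hT := transition_isUnit hA hk
  have hTt : IsUnit (transition A k 0)ᵀ := by
    rw [isUnit_iff_isUnit_det] at hT ⊢
    rwa [det_transpose]
  exact (hT.mul (isUnit_sub_of_inv_lt hG (qMinusInit_isUnit hε hC₀ hG hF)
    (inv_qMinusInit_lt hA hε hC₀ hCN hG hF) (ctrlGramian_posSemidef A B k)
    (ctrlGramian_sub_posSemidef A B hk))).mul hTt

/-- Apply `posDef_one_add_of_inv_lt` at time zero with `E = G_c(k,0)` and `b = Φ(0,k+1) B_k`; then
`E + b bᵀ = G_c(k+1,0)` is still at most `G_c(N,0)`, and the transition matrices in `b` turn `(Q_0 -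
G_c(k+1,0))⁻¹` into `Q_{k+1}⁻¹`. -/
theorem gainWeight_posDef (hA : ∀ k < N, IsUnit (A k)) (hε : 0 < ε) (hC₀ : C₀.PosDef)
    (hCN : CN.PosDef) (hG : (ctrlGramian A B N 0).PosDef)
    (hF : IsUnit (forwardTerm (normalizedInit N A B ε C₀) (normalizedFinal N A B ε CN)))
    {k : ℕ} (hk : k + 1 ≤ N) : (gainWeight N A B ε C₀ CN k).PosDef := by
  have h := posDef_one_add_of_inv_lt (b := transition A 0 (k + 1) * B k) hG
    (qMinusInit_isUnit hε hC₀ hG hF) (qMinusInit_transpose hε hC₀ hG)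
    (inv_qMinusInit_lt hA hε hC₀ hCN hG hF) (ctrlGramian_posSemidef A B k)
    (by rw [← ctrlGramian_succ]; exact ctrlGramian_sub_posSemidef A B hk)
  rw [← ctrlGramian_succ] at h
  convert h using 1
  have e : (transition A (k + 1) 0)⁻¹ = transition A 0 (k + 1) :=
    inv_eq_right_inv (transition_mul_inverse hA hk)
  rw [gainWeight, qMinus_eq hA hk, Matrix.mul_inv_rev, Matrix.mul_inv_rev, ← transpose_nonsing_inv, e,
    transpose_mul]
  simp only [Matrix.mul_assoc]

/-- The feedback gain `Λ_k⁻¹ B_kᵀ Q_{-,k+1}⁻¹ A_k`. -/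
noncomputable def feedbackGain (N : ℕ) (A : ℕ → Matrix (Fin n) (Fin n) ℝ)
    (B : ℕ → Matrix (Fin n) (Fin m) ℝ) (ε : ℝ) (C₀ CN : Matrix (Fin n) (Fin n) ℝ) (k : ℕ) :
    Matrix (Fin m) (Fin n) ℝ :=
  (gainWeight N A B ε C₀ CN k)⁻¹ * (B k)ᵀ * (qMinus N A B ε C₀ CN (k + 1))⁻¹ * A k

/-- The invariant `Q⁻¹ Σ Q⁻¹ - ε Q⁻¹` of the closed loop at time `0`. -/
noncomputable def covInvariant (N : ℕ) (A : ℕ → Matrix (Fin n) (Fin n) ℝ)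
    (B : ℕ → Matrix (Fin n) (Fin m) ℝ) (ε : ℝ) (C₀ CN : Matrix (Fin n) (Fin n) ℝ) :
    Matrix (Fin n) (Fin n) ℝ :=
  (qMinusInit N A B ε C₀ CN)⁻¹ * C₀ * (qMinusInit N A B ε C₀ CN)⁻¹ -
    ε • (qMinusInit N A B ε C₀ CN)⁻¹

/-- The state covariance of the closed loop at time `k`. -/
noncomputable def closedLoopCov (N : ℕ) (A : ℕ → Matrix (Fin n) (Fin n) ℝ)
    (B : ℕ → Matrix (Fin n) (Fin m) ℝ) (ε : ℝ) (C₀ CN : Matrix (Fin n) (Fin n) ℝ) (k : ℕ) :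
    Matrix (Fin n) (Fin n) ℝ :=
  qMinus N A B ε C₀ CN k *
      ((transition A 0 k)ᵀ * covInvariant N A B ε C₀ CN * transition A 0 k) *
      qMinus N A B ε C₀ CN k + ε • qMinus N A B ε C₀ CN k

theorem closedLoopCov_zero (hQ : IsUnit (qMinusInit N A B ε C₀ CN)) :
    closedLoopCov N A B ε C₀ CN 0 = C₀ := by
  have hd := (isUnit_iff_isUnit_det _).1 hQ
  simp only [closedLoopCov, covInvariant, qMinus, transition_zero_zero, transpose_one,
    Matrix.one_mul, Matrix.mul_one, Matrix.mul_sub, Matrix.sub_mul, Matrix.mul_smul,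
    Matrix.smul_mul, Matrix.mul_assoc, mul_nonsing_inv_cancel_left _ _ hd,
    nonsing_inv_mul _ hd]
  abel

theorem closedLoopCov_succ (hA : ∀ k < N, IsUnit (A k)) (hε : 0 < ε) (hC₀ : C₀.PosDef)
    (hCN : CN.PosDef) (hG : (ctrlGramian A B N 0).PosDef)
    (hF : IsUnit (forwardTerm (normalizedInit N A B ε C₀) (normalizedFinal N A B ε CN)))
    {k : ℕ} (hk : k + 1 ≤ N) :
    closedLoopCov N A B ε C₀ CN (k + 1) =
      (A k - B k * feedbackGain N A B ε C₀ CN k) * closedLoopCov N A B ε C₀ CN k *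
        (A k - B k * feedbackGain N A B ε C₀ CN k)ᵀ +
      ε • (B k * (gainWeight N A B ε C₀ CN k)⁻¹ * (B k)ᵀ) := by
  rw [closedLoopCov, closedLoopCov, closedLoop_cov_step (K := feedbackGain N A B ε C₀ CN k)
    (hA k hk)
    (qMinus_isUnit hA hε hC₀ hCN hG hF (by omega)) (qMinus_isUnit hA hε hC₀ hCN hG hF hk)
    (qMinus_transpose hε hC₀ hG k) (qMinus_transpose hε hC₀ hG (k + 1)) rfl
    (gainWeight_posDef hA hε hC₀ hCN hG hF hk).isUnit rfl rfl, transition_zero_succ,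
    transpose_mul]
  simp only [Matrix.mul_assoc]

/-- Pulled back by `Φ(N,0)`, the terminal covariance is `(Q_0 - G) X (Q_0 - G) + ε (Q_0 - G)`. By
`terminal_identity` this is `ε G^{1/2} S_N G^{1/2}`, and the normalization of `S_N` undoes the
scaling. -/
theorem closedLoopCov_final (hA : ∀ k < N, IsUnit (A k)) (hε : 0 < ε) (hC₀ : C₀.PosDef)
    (hCN : CN.PosDef) (hG : (ctrlGramian A B N 0).PosDef)
    (hF : IsUnit (forwardTerm (normalizedInit N A B ε C₀) (normalizedFinal N A B ε CN))) :
    closedLoopCov N A B ε C₀ CN N = CN := by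
  have hS₀ := normalizedInit_posDef (A := A) (B := B) (N := N) hε hC₀ hG
  have hSN := normalizedFinal_posDef (A := A) (B := B) (N := N) hA hε hCN hG
  have hg := (isUnit_iff_isUnit_det _).1 (msqrt_isUnit hG)
  have hs := (isUnit_iff_isUnit_det _).1 (msqrt_isUnit hS₀)
  have hFd := (isUnit_iff_isUnit_det _).1 hF
  have hε' : ε * ε⁻¹ = 1 := mul_inv_cancel₀ hε.ne'
  have key := terminal_identity (ε := ε) (SN := normalizedFinal N A B ε CN)
    (R := rootTerm (normalizedInit N A B ε C₀) (normalizedFinal N A B ε CN))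
    (C := C₀) (X := covInvariant N A B ε C₀ CN)
    (mul_nonsing_inv _ hs) (nonsing_inv_mul _ hs) (mul_nonsing_inv _ hg) (nonsing_inv_mul _ hg)
    (mul_nonsing_inv _ hFd) (nonsing_inv_mul _ hFd) (rootTerm_mul_self hS₀ hSN)
    (by rw [msqrt_mul_self hS₀.posSemidef, forwardTerm]) rfl (inv_qMinusInit hF)
    (by
      rw [Matrix.mul_assoc (msqrt (ctrlGramian A B N 0)), msqrt_mul_self hS₀.posSemidef,
        normalizedInit]
      simp only [Matrix.mul_smul, Matrix.smul_mul, smul_smul, hε', one_smul, Matrix.mul_assoc,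
        mul_nonsing_inv_cancel_left _ _ hg, nonsing_inv_mul _ hg, Matrix.mul_one]) rfl
  change (qMinusInit N A B ε C₀ CN - _) * _ * (qMinusInit N A B ε C₀ CN - _) +
    ε • (qMinusInit N A B ε C₀ CN - _) = _ at key
  rw [msqrt_mul_self hG.posSemidef] at key
  have key2 : ε • (msqrt (ctrlGramian A B N 0) * normalizedFinal N A B ε CN *
      msqrt (ctrlGramian A B N 0)) = transition A 0 N * CN * (transition A 0 N)ᵀ := by
    rw [normalizedFinal]
    simp only [Matrix.mul_smul, Matrix.smul_mul, smul_smul, hε', one_smul, Matrix.mul_assoc,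
        mul_nonsing_inv_cancel_left _ _ hg, nonsing_inv_mul _ hg, Matrix.mul_one]
  have h1 := transition_mul_inverse hA le_rfl
  have h2 := transition_inverse_mul hA le_rfl
  have h1t : (transition A 0 N)ᵀ * (transition A N 0)ᵀ = 1 := by
    rw [← transpose_mul, h1, transpose_one]
  have h2t : (transition A N 0)ᵀ * (transition A 0 N)ᵀ = 1 := by
    rw [← transpose_mul, h2, transpose_one]
  rw [key2] at key
  have a1 (x : Matrix (Fin n) (Fin n) ℝ) : transition A N 0 * (transition A 0 N * x) = x := by
    rw [← Matrix.mul_assoc, h1, Matrix.one_mul]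
  have a2 (x : Matrix (Fin n) (Fin n) ℝ) : transition A 0 N * (transition A N 0 * x) = x := by
    rw [← Matrix.mul_assoc, h2, Matrix.one_mul]
  have a3 (x : Matrix (Fin n) (Fin n) ℝ) :
      (transition A N 0)ᵀ * ((transition A 0 N)ᵀ * x) = x := by
    rw [← Matrix.mul_assoc, h2t, Matrix.one_mul]
  have e : closedLoopCov N A B ε C₀ CN N = transition A N 0 *
      ((qMinusInit N A B ε C₀ CN - ctrlGramian A B N 0) * covInvariant N A B ε C₀ CN *
        (qMinusInit N A B ε C₀ CN - ctrlGramian A B N 0) +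
        ε • (qMinusInit N A B ε C₀ CN - ctrlGramian A B N 0)) * (transition A N 0)ᵀ := by
    rw [closedLoopCov, qMinus_eq hA le_rfl]
    generalize qMinusInit N A B ε C₀ CN - ctrlGramian A B N 0 = D
    simp only [Matrix.mul_add, Matrix.add_mul, Matrix.mul_smul, Matrix.smul_mul,
      Matrix.mul_assoc, a2, a3]
  rw [e, key]
  simp only [Matrix.mul_assoc, a1, h1t, Matrix.mul_one]

end RiccatiTrajectory

/-! ### Steering of the mean by the minimum-energy input. -/

section MeanSteering

variable {n m : ℕ} {N : ℕ} {A : ℕ → Matrix (Fin n) (Fin n) ℝ} {B : ℕ → Matrix (Fin n) (Fin m) ℝ}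
  {μ₀ μN : Fin n → ℝ}

theorem meanState_zero : meanState N A B μ₀ μN 0 = μ₀ := by
  simp [meanState, transition_zero_zero]

/-- Variation of constants. -/
theorem state_eq_sum (hA : ∀ k < N, IsUnit (A k)) {y : ℕ → Fin n → ℝ} {w : ℕ → Fin m → ℝ}
    (hy : ∀ k < N, y (k + 1) = A k *ᵥ y k + B k *ᵥ w k) {k : ℕ} (hk : k ≤ N) :
    y k = transition A k 0 *ᵥ y 0 +
      ∑ s ∈ Finset.range k, (transition A k (s + 1) * B s) *ᵥ w s := by
  induction k with
  | zero => simp [transition_zero_zero]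
  | succ k ih =>
    have h1 : transition A (k + 1) (k + 1) = 1 := by simp [transition, forwardProd]
    have h2 : ∀ s ∈ Finset.range k, (transition A (k + 1) (s + 1) * B s) *ᵥ w s
        = A k *ᵥ ((transition A k (s + 1) * B s) *ᵥ w s) := by
      intro s hs
      have hs' := Finset.mem_range.1 hs
      rw [transition_eq_mul hA hk (by omega), transition_eq_mul hA (k := k) (by omega) (by omega),
        transition_succ_zero, mulVec_mulVec]
      simp only [Matrix.mul_assoc]
    rw [hy k hk, ih (by omega), Finset.sum_range_succ, h1, Matrix.one_mul, Finset.sum_congr rfl h2,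
      transition_succ_zero, mulVec_add, mulVec_mulVec, mulVec_sum, add_assoc]

theorem meanState_succ (hA : ∀ k < N, IsUnit (A k)) {k : ℕ} (hk : k < N) :
    meanState N A B μ₀ μN (k + 1)
      = A k *ᵥ meanState N A B μ₀ μN k + B k *ᵥ meanInput N A B μ₀ μN k := by
  -- The closed formula is compared with the trajectory defined by recursion, to which variation of
  -- constants applies.
  let y : ℕ → Fin n → ℝ := fun k => Nat.rec μ₀
    (fun k yk => A k *ᵥ yk + B k *ᵥ meanInput N A B μ₀ μN k) k
  have hy : ∀ k < N, y (k + 1) = A k *ᵥ y k + B k *ᵥ meanInput N A B μ₀ μN k := fun k _ => rfl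
  have h : ∀ k ≤ N, meanState N A B μ₀ μN k = y k := fun k hk => (state_eq_sum hA hy hk).symm
  rw [h _ hk, h _ hk.le, hy k hk]

/-- Summing the contributions of the inputs at time `N` reproduces the Gramian, which cancels its
inverse. -/
theorem meanState_final (hG : IsUnit (reachGramian A B N 0)) :
    meanState N A B μ₀ μN N = μN := by
  have h : ∑ s ∈ Finset.range N, (transition A N (s + 1) * B s) *ᵥ meanInput N A B μ₀ μN s
      = (reachGramian A B N 0 * (reachGramian A B N 0)⁻¹) *ᵥ (μN - transition A N 0 *ᵥ μ₀) := by
    rw [← mulVec_mulVec]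
    generalize hv : (reachGramian A B N 0)⁻¹ *ᵥ (μN - transition A N 0 *ᵥ μ₀) = v
    rw [reachGramian, ← Finset.range_eq_Ico, sum_mulVec]
    refine Finset.sum_congr rfl fun s _ => ?_
    simp only [← hv, meanInput, mulVec_mulVec, Matrix.mul_assoc]
  rw [meanState, h, mul_nonsing_inv _ ((isUnit_iff_isUnit_det _).1 hG), one_mulVec]
  abel

/-- Along any trajectory, the correlation of the inputs with the mean-steering input depends only
on the end points. -/
theorem sum_meanInput_dotProduct (hA : ∀ k < N, IsUnit (A k)) {y : ℕ → Fin n → ℝ}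
    {w : ℕ → Fin m → ℝ} (hy : ∀ k < N, y (k + 1) = A k *ᵥ y k + B k *ᵥ w k) :
    ∑ k ∈ Finset.range N, meanInput N A B μ₀ μN k ⬝ᵥ w k
      = ((reachGramian A B N 0)⁻¹ *ᵥ (μN - transition A N 0 *ᵥ μ₀)) ⬝ᵥ
        (y N - transition A N 0 *ᵥ y 0) := by
  rw [state_eq_sum hA hy le_rfl, add_sub_cancel_left, dotProduct_sum]
  refine Finset.sum_congr rfl fun k _ => ?_
  rw [meanInput, ← mulVec_mulVec, ← transpose_mul, dotProduct_mulVec_transpose]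

end MeanSteering

/-! ### Gaussian densities as affine images of standard noise. -/

section Gaussian

variable {n m : ℕ}

open ProbabilityTheory in
/-- The standard Gaussian law on `ℝ^m`. -/
noncomputable def stdNormal (m : ℕ) : Measure (Fin m → ℝ) :=
  Measure.pi fun _ => gaussianReal 0 1

instance stdNormal_isProbabilityMeasure (m : ℕ) : IsProbabilityMeasure (stdNormal m) := by
  unfold stdNormal; infer_instance

-- On a box the indicator splits over the coordinates, so the integral of the product density is the
-- product of the one-dimensional Gaussian masses; boxes determine the product measure.
open ProbabilityTheory in
theorem stdNormal_eq_withDensity (m : ℕ) :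
    stdNormal m = volume.withDensity
      (fun v : Fin m → ℝ => ENNReal.ofReal (∏ i, gaussianPDFReal 0 1 (v i))) := by
  refine Measure.pi_eq fun s hs => ?_
  have hmeas : MeasurableSet (Set.univ.pi s) := MeasurableSet.univ_pi hs
  have hint (i : Fin m) : Integrable ((s i).indicator (gaussianPDFReal 0 1)) :=
    (integrable_gaussianPDFReal 0 1).indicator (hs i)
  have hnn (i : Fin m) (x : ℝ) : 0 ≤ (s i).indicator (gaussianPDFReal 0 1) x :=
    Set.indicator_nonneg (fun y _ => gaussianPDFReal_nonneg 0 1 y) x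
  have h1 : (Set.univ.pi s).indicator
      (fun v : Fin m → ℝ => ENNReal.ofReal (∏ i, gaussianPDFReal 0 1 (v i)))
      = fun v => ENNReal.ofReal (∏ i, (s i).indicator (gaussianPDFReal 0 1) (v i)) := by
    funext v
    by_cases hv : v ∈ Set.univ.pi s
    · rw [Set.indicator_of_mem hv]
      congr 1
      exact Finset.prod_congr rfl fun i _ => (Set.indicator_of_mem (hv i trivial) _).symm
    · rw [Set.indicator_of_notMem hv]
      simp only [Set.mem_univ_pi, not_forall] at hv
      obtain ⟨i, hi⟩ := hv
      rw [Finset.prod_eq_zero (Finset.mem_univ i) (Set.indicator_of_notMem hi _),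
        ENNReal.ofReal_zero]
  have hI : Integrable (fun v : Fin m → ℝ => ∏ i, (s i).indicator (gaussianPDFReal 0 1) (v i)) :=
    Integrable.fintype_prod hint
  rw [withDensity_apply _ hmeas, ← lintegral_indicator hmeas, h1,
    ← ofReal_integral_eq_lintegral_ofReal hI (Filter.Eventually.of_forall fun v =>
        Finset.prod_nonneg fun i _ => hnn i (v i)),
    integral_fintype_prod_volume_eq_prod (fun i => (s i).indicator (gaussianPDFReal 0 1)),
    ENNReal.ofReal_prod_of_nonneg fun i _ => integral_nonneg (hnn i)]
  refine Finset.prod_congr rfl fun i _ => ?_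
  rw [integral_indicator (hs i), gaussianReal_apply_eq_integral _ one_ne_zero]

theorem continuous_gaussianDensity {X : Type*} [TopologicalSpace X] {c u : X → Fin m → ℝ}
    (C : Matrix (Fin m) (Fin m) ℝ) (hc : Continuous c) (hu : Continuous u) :
    Continuous fun z => gaussianDensity (c z) C (u z) := by
  unfold gaussianDensity
  have h : Continuous fun z => u z - c z := hu.sub hc
  exact continuous_const.mul (Real.continuous_exp.comp (continuous_const.mul
    (h.dotProduct (continuous_const.matrix_mulVec h))))

open ProbabilityTheory in
theorem abs_det_mul_gaussianDensity {L : Matrix (Fin m) (Fin m) ℝ} (hL : L.det ≠ 0)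
    (c v : Fin m → ℝ) :
    |L.det| * gaussianDensity c (L * Lᵀ) (c + L *ᵥ v) = ∏ i, gaussianPDFReal 0 1 (v i) := by
  have hLu : IsUnit L.det := isUnit_iff_ne_zero.2 hL
  have h1 : (L *ᵥ v) ⬝ᵥ ((L * Lᵀ)⁻¹ *ᵥ (L *ᵥ v)) = v ⬝ᵥ v := by
    have e1 : L⁻¹ *ᵥ (L *ᵥ v) = v := by
      rw [mulVec_mulVec, nonsing_inv_mul _ hLu, one_mulVec]
    have e2 (w : Fin m → ℝ) : (L *ᵥ v) ⬝ᵥ w = v ⬝ᵥ (Lᵀ *ᵥ w) := by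
      rw [← dotProduct_mulVec_transpose, transpose_transpose]
    rw [Matrix.mul_inv_rev, ← mulVec_mulVec, e1, e2, mulVec_mulVec,
      mul_nonsing_inv _ (by rwa [det_transpose]), one_mulVec]
  have h2 : Real.sqrt ((2 * Real.pi) ^ m * (L * Lᵀ).det)
      = Real.sqrt (2 * Real.pi) ^ m * |L.det| := by
    have e : (2 * Real.pi) ^ m = (Real.sqrt (2 * Real.pi) ^ m) ^ 2 := by
      rw [← pow_mul, mul_comm m, pow_mul, Real.sq_sqrt (by positivity)]
    rw [det_mul, det_transpose, Real.sqrt_mul (by positivity), ← sq, Real.sqrt_sq_eq_abs, e,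
      Real.sqrt_sq (by positivity)]
  have h3 : |L.det| ≠ 0 := abs_ne_zero.2 hL
  rw [gaussianDensity, add_sub_cancel_left, h1, h2]
  simp only [gaussianPDFReal, NNReal.coe_one, mul_one, sub_zero]
  rw [Finset.prod_mul_distrib, Finset.prod_const, Finset.card_univ, Fintype.card_fin,
    ← Real.exp_sum, dotProduct, Finset.mul_sum, mul_inv, inv_pow]
  have h4 : ∑ i, -(1 / 2) * (v i * v i) = ∑ i, -v i ^ 2 / 2 :=
    Finset.sum_congr rfl fun i _ => by ring
  rw [h4]
  field_simp

/-- Change of variables: translation by `c`, then the linear map `L`, whose Jacobian is matched by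
the normalizing factor in `abs_det_mul_gaussianDensity`. Moments of the candidate policy can thus be
computed from those of `stdNormal`. -/
theorem map_stdNormal_affine {L : Matrix (Fin m) (Fin m) ℝ} (hL : L.det ≠ 0) (c : Fin m → ℝ) :
    (stdNormal m).map (fun v => c + L *ᵥ v)
      = volume.withDensity (fun u => ENNReal.ofReal (gaussianDensity c (L * Lᵀ) u)) := by
  have hLc : Continuous fun v : Fin m → ℝ => L *ᵥ v := continuous_const.matrix_mulVec continuous_id
  have hdens : Measurable fun u => ENNReal.ofReal (gaussianDensity c (L * Lᵀ) u) :=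
    (continuous_gaussianDensity (c := fun _ => c) _ continuous_const
      continuous_id).measurable.ennreal_ofReal
  refine Measure.ext_of_lintegral _ fun φ hφ => ?_
  have hLcm : Measurable fun v : Fin m → ℝ => c + L *ᵥ v := (continuous_const.add hLc).measurable
  have hφ' : Measurable fun v => φ (c + L *ᵥ v) := hφ.comp hLcm
  have hdens' : Measurable fun v : Fin m → ℝ =>
      ENNReal.ofReal (∏ i, ProbabilityTheory.gaussianPDFReal 0 1 (v i)) :=
    (Finset.measurable_prod _ fun i _ => (ProbabilityTheory.measurable_gaussianPDFReal 0 1).comp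
      (measurable_pi_apply i)).ennreal_ofReal
  have hprod : Measurable fun u => ENNReal.ofReal (gaussianDensity c (L * Lᵀ) u) * φ u :=
    hdens.mul hφ
  have hprod' : Measurable fun w => ENNReal.ofReal (gaussianDensity c (L * Lᵀ) (c + w)) * φ (c + w) :=
    hprod.comp (measurable_const_add c)
  have hLin : Measurable (toLin' L) := by
    apply Continuous.measurable
    apply LinearMap.continuous_on_pi
  rw [lintegral_map hφ hLcm, stdNormal_eq_withDensity,
    lintegral_withDensity_eq_lintegral_mul _ hdens' hφ',
    lintegral_withDensity_eq_lintegral_mul _ hdens hφ]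
  simp only [Pi.mul_apply]
  have h1 := lintegral_add_left_eq_self (μ := (volume : Measure (Fin m → ℝ)))
    (fun u => ENNReal.ofReal (gaussianDensity c (L * Lᵀ) u) * φ u) c
  have h2 := congrArg (fun μ => ∫⁻ w, ENNReal.ofReal (gaussianDensity c (L * Lᵀ) (c + w)) *
    φ (c + w) ∂μ) (Real.map_matrix_volume_pi_eq_smul_volume_pi hL)
  simp only [lintegral_smul_measure, smul_eq_mul] at h2
  rw [lintegral_map hprod' hLin, h1] at h2
  simp only [toLin'_apply] at h2
  have h3 : ENNReal.ofReal |L.det| * ENNReal.ofReal |(L.det)⁻¹| = 1 := by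
    rw [← ENNReal.ofReal_mul (abs_nonneg _), ← abs_mul, mul_inv_cancel₀ hL, abs_one,
      ENNReal.ofReal_one]
  rw [← one_mul (lintegral _ (fun u => ENNReal.ofReal (gaussianDensity c (L * Lᵀ) u) * φ u)), ← h3,
    mul_assoc, ← h2, ← lintegral_const_mul _ (by
      exact hprod'.comp hLc.measurable)]
  refine lintegral_congr fun v => ?_
  rw [← mul_assoc, ← ENNReal.ofReal_mul (abs_nonneg _), abs_det_mul_gaussianDensity hL]

theorem lintegral_gaussianDensity {L : Matrix (Fin m) (Fin m) ℝ} (hL : L.det ≠ 0) (c : Fin m → ℝ) :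
    ∫⁻ u, ENNReal.ofReal (gaussianDensity c (L * Lᵀ) u) = 1 := by
  have h : ((stdNormal m).map (fun v => c + L *ᵥ v)) Set.univ = 1 := by
    have hLc : Continuous fun v : Fin m → ℝ => c + L *ᵥ v :=
      continuous_const.add (continuous_const.matrix_mulVec continuous_id)
    rw [Measure.map_apply hLc.measurable MeasurableSet.univ, Set.preimage_univ, measure_univ]
  rwa [map_stdNormal_affine hL, withDensity_apply _ MeasurableSet.univ, Measure.restrict_univ] at h

/-- A Gaussian control with state-dependent mean is an affine image of independent noise. -/
theorem stepLaw_gaussianDensity (ρ : Measure (Fin n → ℝ)) [SFinite ρ]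
    {L : Matrix (Fin m) (Fin m) ℝ} (hL : L.det ≠ 0) {c : (Fin n → ℝ) → Fin m → ℝ}
    (hc : Continuous c) :
    stepLaw ρ (fun x u => gaussianDensity (c x) (L * Lᵀ) u)
      = (ρ.prod (stdNormal m)).map (fun z => (z.1, c z.1 + L *ᵥ z.2)) := by
  have hmap : Measurable fun z : (Fin n → ℝ) × (Fin m → ℝ) => (z.1, c z.1 + L *ᵥ z.2) :=
    (continuous_fst.prodMk ((hc.comp continuous_fst).add
      (continuous_const.matrix_mulVec continuous_snd))).measurable
  have hdens : Measurable fun z : (Fin n → ℝ) × (Fin m → ℝ) =>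
      ENNReal.ofReal (gaussianDensity (c z.1) (L * Lᵀ) z.2) :=
    (continuous_gaussianDensity _ (hc.comp continuous_fst) continuous_snd).measurable.ennreal_ofReal
  refine Measure.ext_of_lintegral _ fun φ hφ => ?_
  have hφm : Measurable fun z : (Fin n → ℝ) × (Fin m → ℝ) => φ (z.1, c z.1 + L *ᵥ z.2) :=
    hφ.comp hmap
  have hφx (x : Fin n → ℝ) : Measurable fun u => φ (x, u) := hφ.comp measurable_prodMk_left
  have hdx (x : Fin n → ℝ) :
      Measurable fun u => ENNReal.ofReal (gaussianDensity (c x) (L * Lᵀ) u) :=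
    (continuous_gaussianDensity (c := fun _ => c x) _ continuous_const
      continuous_id).measurable.ennreal_ofReal
  have hLx (x : Fin n → ℝ) : Measurable fun v : Fin m → ℝ => c x + L *ᵥ v :=
    (continuous_const.add (continuous_const.matrix_mulVec continuous_id)).measurable
  have hmul : Measurable fun z : (Fin n → ℝ) × (Fin m → ℝ) =>
      ENNReal.ofReal (gaussianDensity (c z.1) (L * Lᵀ) z.2) * φ z := hdens.mul hφ
  have hleft : ∫⁻ z, φ z ∂(stepLaw ρ fun x u => gaussianDensity (c x) (L * Lᵀ) u)
      = ∫⁻ x, ∫⁻ u, ENNReal.ofReal (gaussianDensity (c x) (L * Lᵀ) u) * φ (x, u)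
          ∂volume ∂ρ := by
    rw [stepLaw, lintegral_withDensity_eq_lintegral_mul _ hdens hφ]
    exact lintegral_prod _ hmul.aemeasurable
  rw [hleft, lintegral_map hφ hmap, lintegral_prod _ hφm.aemeasurable]
  refine lintegral_congr fun x => ?_
  have h1 := lintegral_withDensity_eq_lintegral_mul volume (hdx x) (hφx x)
  rw [← map_stdNormal_affine hL, lintegral_map (hφx x) (hLx x)] at h1
  exact h1.symm

end Gaussian

/-! ### Means and covariances of affine images. -/

section Moments

variable {n m : ℕ}

open ProbabilityTheory in
theorem stdNormal_hasMeanCov (m : ℕ) : HasMeanCov (stdNormal m) 0 1 := by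
  have hL (i : Fin m) : MemLp (fun v : Fin m → ℝ => v i) 2 (stdNormal m) :=
    (memLp_id_gaussianReal' (μ := 0) (v := 1) 2 (by simp)).comp_measurePreserving
      (measurePreserving_eval (fun _ : Fin m => gaussianReal 0 1) i)
  have hmean (i : Fin m) : ∫ v, v i ∂(stdNormal m) = 0 := by
    rw [stdNormal, integral_eval, integral_id_gaussianReal]
  refine ⟨hL, hmean, fun i j => ?_⟩
  simp only [Pi.zero_apply, sub_zero]
  by_cases hij : i = j
  · subst hij
    rw [one_apply_eq, stdNormal, integral_comp_eval (μ := fun _ : Fin m => gaussianReal 0 1)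
      (f := fun x : ℝ => x * x) (i := i) (by fun_prop)]
    have h := variance_fun_id_gaussianReal (μ := 0) (v := 1)
    rw [variance_eq_integral aemeasurable_id', integral_id_gaussianReal] at h
    simpa [sq] using h
  · rw [one_apply_ne hij]
    have hind : iIndepFun (fun (i : Fin m) (v : Fin m → ℝ) => v i) (stdNormal m) :=
      iIndepFun_pi (μ := fun _ : Fin m => gaussianReal 0 1) (X := fun _ x => x)
        fun _ => aemeasurable_id'
    have h := (hind.indepFun hij).integral_mul_eq_mul_integral (hL i).aestronglyMeasurable
      (hL j).aestronglyMeasurable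
    simp only [Pi.mul_apply] at h
    rw [h, hmean, zero_mul]

theorem HasMeanCov.integrable_coord {ρ : Measure (Fin n → ℝ)} [IsFiniteMeasure ρ] {c : Fin n → ℝ}
    {C : Matrix (Fin n) (Fin n) ℝ} (h : HasMeanCov ρ c C) (i : Fin n) :
    Integrable (fun x => x i) ρ :=
  (h.memLp i).integrable one_le_two

theorem integral_mul_linear_combination {Ω ι κ : Type*} [MeasurableSpace Ω] {ρ : Measure Ω}
    [Fintype ι] {f : ι → Ω → ℝ} (hf : ∀ s, MemLp (f s) 2 ρ) {D : Matrix ι ι ℝ}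
    (hD : ∀ s t, ∫ ω, f s ω * f t ω ∂ρ = D s t) (W : Matrix κ ι ℝ) (i j : κ) :
    ∫ ω, (∑ s, W i s * f s ω) * (∑ t, W j t * f t ω) ∂ρ = (W * D * Wᵀ) i j := by
  have hint (s t : ι) : Integrable (fun ω => (W i s * W j t) * (f s ω * f t ω)) ρ :=
    ((hf s).integrable_mul (hf t)).const_mul _
  have e (ω : Ω) : (∑ s, W i s * f s ω) * (∑ t, W j t * f t ω)
      = ∑ s, ∑ t, (W i s * W j t) * (f s ω * f t ω) := by
    rw [Finset.sum_mul_sum]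
    exact Finset.sum_congr rfl fun s _ => Finset.sum_congr rfl fun t _ => by ring
  simp only [e]
  rw [integral_finsetSum _ fun s _ => integrable_finsetSum _ fun t _ => hint s t]
  simp only [mul_apply, transpose_apply, Finset.sum_mul]
  rw [Finset.sum_comm]
  refine Finset.sum_congr rfl fun s _ => ?_
  rw [integral_finsetSum _ fun t _ => hint s t]
  refine Finset.sum_congr rfl fun t _ => ?_
  rw [integral_const_mul, hD]
  ring

theorem integral_linear_combination_eq_zero {Ω ι : Type*} [MeasurableSpace Ω] {ρ : Measure Ω}
    [Fintype ι] {f : ι → Ω → ℝ} (hf : ∀ s, Integrable (f s) ρ) (h0 : ∀ s, ∫ ω, f s ω ∂ρ = 0)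
    (w : ι → ℝ) : ∫ ω, ∑ s, w s * f s ω ∂ρ = 0 := by
  rw [integral_finsetSum _ fun s _ => (hf s).const_mul _]
  simp only [integral_const_mul, h0, mul_zero, Finset.sum_const_zero]

/-- Mean and covariance of an affine image of a pair of independent vectors, the second of which is
normalized. -/
theorem HasMeanCov.map_affine {p : ℕ} {ρ : Measure (Fin n → ℝ)} [IsProbabilityMeasure ρ]
    {γ : Measure (Fin m → ℝ)} [IsProbabilityMeasure γ] {c : Fin n → ℝ}
    {C : Matrix (Fin n) (Fin n) ℝ} (hρ : HasMeanCov ρ c C) (hγ : HasMeanCov γ 0 1)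
    (M : Matrix (Fin p) (Fin n) ℝ) (L : Matrix (Fin p) (Fin m) ℝ) (b : Fin p → ℝ) :
    HasMeanCov ((ρ.prod γ).map fun z => M *ᵥ z.1 + L *ᵥ z.2 + b) (M *ᵥ c + b)
      (M * C * Mᵀ + L * Lᵀ) := by
  -- The centred state and the noise are treated as one vector with block-diagonal second-moment
  -- matrix `D`. The centred image is `W` applied to it, so its covariance is `W D Wᵀ`.
  let f : Fin n ⊕ Fin m → (Fin n → ℝ) × (Fin m → ℝ) → ℝ :=
    Sum.elim (fun i z => z.1 i - c i) (fun j z => z.2 j)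
  let W : Matrix (Fin p) (Fin n ⊕ Fin m) ℝ := fromCols M L
  have hf : ∀ s, MemLp (f s) 2 (ρ.prod γ) := by
    rintro (i | j)
    · exact ((hρ.memLp i).sub (memLp_const (c i))).comp_measurePreserving measurePreserving_fst
    · exact (hγ.memLp j).comp_measurePreserving measurePreserving_snd
  have hmeanx (i : Fin n) : ∫ x, (x i - c i) ∂ρ = 0 := by
    rw [integral_sub (hρ.integrable_coord i) (integrable_const _), hρ.mean]
    simp
  have hfst (g : (Fin n → ℝ) → ℝ) : ∫ z, g z.1 ∂(ρ.prod γ) = ∫ x, g x ∂ρ := by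
    have := integral_prod_mul (μ := ρ) (ν := γ) g (fun _ => 1)
    simpa using this
  have hsnd (g : (Fin m → ℝ) → ℝ) : ∫ z, g z.2 ∂(ρ.prod γ) = ∫ x, g x ∂γ := by
    have := integral_prod_mul (μ := ρ) (ν := γ) (fun _ => 1) g
    simpa using this
  have hf0 : ∀ s, ∫ z, f s z ∂(ρ.prod γ) = 0 := by
    rintro (i | j)
    · exact (hfst fun x : Fin n → ℝ => x i - c i).trans (hmeanx i)
    · exact (hsnd fun x : Fin m → ℝ => x j).trans (hγ.mean j)
  let D : Matrix (Fin n ⊕ Fin m) (Fin n ⊕ Fin m) ℝ := fromBlocks C 0 0 1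
  have hD : ∀ s t, ∫ z, f s z * f t z ∂(ρ.prod γ) = D s t := by
    rintro (i | i) (j | j)
    · exact (hfst fun x : Fin n → ℝ => (x i - c i) * (x j - c j)).trans (hρ.cov i j)
    · refine (integral_prod_mul (fun x : Fin n → ℝ => x i - c i) fun v : Fin m → ℝ => v j).trans ?_
      rw [hmeanx, zero_mul]; rfl
    · have e : ∀ z, f (Sum.inr i) z * f (Sum.inl j) z = (z.1 j - c j) * z.2 i :=
        fun z => mul_comm _ _
      simp only [e]
      refine (integral_prod_mul (fun x : Fin n → ℝ => x j - c j) fun v : Fin m → ℝ => v i).trans ?_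
      rw [hmeanx, zero_mul]; rfl
    · refine (hsnd fun x : Fin m → ℝ => x i * x j).trans ?_
      have h := hγ.cov i j
      simp only [Pi.zero_apply, sub_zero] at h
      exact h
  have hW : W * D * Wᵀ = M * C * Mᵀ + L * Lᵀ := by
    simp [W, D, fromCols_mul_fromBlocks, transpose_fromCols, fromCols_mul_fromRows]
  have hy (i : Fin p) (z : (Fin n → ℝ) × (Fin m → ℝ)) :
      (M *ᵥ z.1 + L *ᵥ z.2 + b) i = (M *ᵥ c + b) i + ∑ s, W i s * f s z := by
    simp only [Fintype.sum_sum_type, W, fromCols_apply_inl, fromCols_apply_inr, f, Sum.elim_inl,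
      Sum.elim_inr, mul_sub, Finset.sum_sub_distrib, Pi.add_apply, mulVec, dotProduct]
    ring
  have hmap : Measurable fun z : (Fin n → ℝ) × (Fin m → ℝ) => M *ᵥ z.1 + L *ᵥ z.2 + b :=
    (((continuous_const.matrix_mulVec continuous_fst).add
      (continuous_const.matrix_mulVec continuous_snd)).add continuous_const).measurable
  have hS (i : Fin p) : MemLp (fun z => ∑ s, W i s * f s z) 2 (ρ.prod γ) :=
    memLp_finsetSum _ fun s _ => (hf s).const_mul _
  refine ⟨fun i => ?_, fun i => ?_, fun i j => ?_⟩
  · rw [memLp_map_measure_iff (measurable_pi_apply i).aestronglyMeasurable hmap.aemeasurable]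
    have : ((fun x : Fin p → ℝ => x i) ∘ fun z : (Fin n → ℝ) × (Fin m → ℝ) =>
        M *ᵥ z.1 + L *ᵥ z.2 + b) = fun z => (M *ᵥ c + b) i + ∑ s, W i s * f s z :=
      funext (hy i)
    rw [this]
    have hconst : MemLp (fun _ : (Fin n → ℝ) × (Fin m → ℝ) => (M *ᵥ c + b) i) 2 (ρ.prod γ) :=
      memLp_const _
    exact hconst.add (hS i)
  · rw [integral_map hmap.aemeasurable (measurable_pi_apply i).aestronglyMeasurable]
    simp only [hy]
    rw [integral_add (integrable_const _) ((hS i).integrable one_le_two),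
      integral_linear_combination_eq_zero (fun s => (hf s).integrable one_le_two) hf0]
    simp
  · rw [integral_map hmap.aemeasurable (by fun_prop)]
    simp only [hy, add_sub_cancel_left]
    rw [integral_mul_linear_combination hf hD, hW]

end Moments

/-! ### Extended-real integrals, entropy and relative entropy. -/

section Entropy

/-- Only `d` and `r` may be infinite, and the hypothesis makes them infinite together; otherwise
everything is real arithmetic. -/
theorem ereal_sub_eq_of_add_eq {a b d e r : ENNReal} (ha : a ≠ ⊤) (hb : b ≠ ⊤) (he : e ≠ ⊤)
    (h : a + b + d = r + e) :
    (a : EReal) - (r : EReal) = ((e.toReal - b.toReal : ℝ) : EReal) - (d : EReal) := by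
  by_cases hd : d = ⊤
  · subst hd
    have hr : r = ⊤ := by
      rw [add_top] at h
      exact (ENNReal.add_eq_top.1 h.symm).resolve_right he
    subst hr
    lift a to NNReal using ha
    simp only [EReal.coe_ennreal_top]
    rw [EReal.sub_top, EReal.sub_top]
  · have hr : r ≠ ⊤ := by
      intro hr
      rw [hr, top_add] at h
      exact (ENNReal.add_ne_top.2 ⟨ENNReal.add_ne_top.2 ⟨ha, hb⟩, hd⟩) h
    lift a to NNReal using ha
    lift b to NNReal using hb
    lift d to NNReal using hd
    lift e to NNReal using he
    lift r to NNReal using hr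
    have h' : (a : ℝ) + b + d = r + e := by exact_mod_cast h
    simp only [ENNReal.coe_toReal, EReal.coe_nnreal_eq_coe_real]
    rw [← EReal.coe_sub, ← EReal.coe_sub, EReal.coe_eq_coe_iff]
    linarith

/-- This is `f = h - d` split into positive and negative parts and rearranged so that only sums of
nonnegative terms occur. In this form it can be integrated without meeting `∞ - ∞`. -/
theorem toENNReal_sub_add (h : ℝ) (d : ENNReal) :
    ((h : EReal) - (d : EReal)).toENNReal + (ENNReal.ofReal (-h) + d)
      = (-((h : EReal) - (d : EReal))).toENNReal + ENNReal.ofReal h := by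
  by_cases hd : d = ⊤
  · subst hd
    simp
  · lift d to NNReal using hd
    simp only [EReal.coe_nnreal_eq_coe_real]
    rw [← EReal.coe_sub, ← EReal.coe_neg, EReal.toENNReal_of_ne_top (EReal.coe_ne_top _),
      EReal.toENNReal_of_ne_top (EReal.coe_ne_top _), EReal.toReal_coe, EReal.toReal_coe,
      ← ENNReal.ofReal_coe_nnreal (p := d)]
    have hd0 : (0 : ℝ) ≤ d := d.coe_nonneg
    rcases le_total 0 h with h0 | h0 <;> rcases le_total 0 (h - d) with h1 | h1
    · rw [ENNReal.ofReal_of_nonpos (by linarith : -h ≤ 0),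
        ENNReal.ofReal_of_nonpos (by linarith : -(h - d) ≤ 0), zero_add, zero_add,
        ← ENNReal.ofReal_add h1 hd0, sub_add_cancel]
    · rw [ENNReal.ofReal_of_nonpos (by linarith : -h ≤ 0), ENNReal.ofReal_of_nonpos h1, zero_add,
        zero_add, ← ENNReal.ofReal_add (by linarith) h0]
      congr 1; ring
    · have e1 : h = 0 := by linarith
      have e2 : (d : ℝ) = 0 := by linarith
      simp [e1, e2]
    · rw [ENNReal.ofReal_of_nonpos h0, ENNReal.ofReal_of_nonpos h1, zero_add, add_zero,
        ← ENNReal.ofReal_add (by linarith) hd0]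
      congr 1; ring

/-- The extended integral of the difference of an integrable and a nonnegative function. -/
theorem extIntegral_sub {α : Type*} [MeasurableSpace α] {ρ : Measure α} {h : α → ℝ}
    (hh : Integrable h ρ) {d : α → ENNReal} (hd : AEMeasurable d ρ) {f : α → EReal}
    (hf : ∀ᵐ a ∂ρ, f a = (h a : EReal) - (d a : EReal)) :
    extIntegral ρ f
      = ((∫ a, h a ∂ρ : ℝ) : EReal) - ((∫⁻ a, d a ∂ρ : ENNReal) : EReal) := by
  have hp : AEMeasurable (fun a => ENNReal.ofReal (h a)) ρ := hh.aemeasurable.ennreal_ofReal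
  have hn : AEMeasurable (fun a => ENNReal.ofReal (-h a)) ρ := hh.aemeasurable.neg.ennreal_ofReal
  have hpt : ∫⁻ a, ENNReal.ofReal (h a) ∂ρ ≠ ⊤ := hh.lintegral_lt_top.ne
  have hnt : ∫⁻ a, ENNReal.ofReal (-h a) ∂ρ ≠ ⊤ := hh.neg.lintegral_lt_top.ne
  have hsum : ∫⁻ a, (f a).toENNReal ∂ρ + ∫⁻ a, ENNReal.ofReal (-h a) ∂ρ + ∫⁻ a, d a ∂ρ
      = ∫⁻ a, (-f a).toENNReal ∂ρ + ∫⁻ a, ENNReal.ofReal (h a) ∂ρ := by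
    have hnd : AEMeasurable (fun a => ENNReal.ofReal (-h a) + d a) ρ := hn.add hd
    rw [add_assoc, ← lintegral_add_left' hn, ← lintegral_add_right' _ hnd,
      ← lintegral_add_right' _ hp]
    refine lintegral_congr_ae ?_
    filter_upwards [hf] with a ha
    rw [ha]
    exact toENNReal_sub_add (h a) (d a)
  -- Because `d ≥ 0`, the positive part of `f` is dominated by that of `h` and has finite integral;
  -- this is what rules out `∞ - ∞`.
  have hle : ∫⁻ a, (f a).toENNReal ∂ρ ≤ ∫⁻ a, ENNReal.ofReal (h a) ∂ρ := by
    refine lintegral_mono_ae ?_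
    filter_upwards [hf] with a ha
    rw [ha, ← EReal.real_coe_toENNReal]
    refine EReal.toENNReal_le_toENNReal ?_
    simpa using EReal.sub_le_sub (le_refl (h a : EReal)) (EReal.coe_ennreal_nonneg (d a))
  rw [extIntegral, ereal_sub_eq_of_add_eq (ne_top_of_le_ne_top hpt hle) hnt hpt hsum,
    integral_eq_lintegral_pos_part_sub_lintegral_neg_part hh]

open InformationTheory

variable {n m : ℕ}

/-- The relative entropy `∫ q log (q / g)` of two densities, as an integral of a nonnegative
function. -/
noncomputable def relEntropy (q g : (Fin m → ℝ) → ℝ) : ENNReal :=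
  ∫⁻ u, ENNReal.ofReal (g u * klFun (q u / g u))

/-- Here `klFun t = t log t + 1 - t`. The correction `b - a`, which integrates to zero for two
probability densities, makes the relative-entropy integrand nonnegative pointwise. The case `a = 0`
uses `log 0 = 0`. -/
theorem neg_mul_log_eq {a b : ℝ} (hb : 0 < b) :
    -(a * Real.log a) = (-(a * Real.log b) - a + b) - b * klFun (a / b) := by
  rw [klFun_apply]
  by_cases h : a = 0
  · simp [h]
  · rw [Real.log_div h hb.ne']
    field_simp
    ring

theorem integrable_of_lintegral_ofReal_eq_one {q : (Fin m → ℝ) → ℝ} (hq : Measurable q)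
    (hq0 : ∀ u, 0 ≤ q u) (hq1 : ∫⁻ u, ENNReal.ofReal (q u) = 1) : Integrable q := by
  refine ⟨hq.aestronglyMeasurable, ?_⟩
  rw [hasFiniteIntegral_iff_ofReal (Filter.Eventually.of_forall hq0), hq1]
  exact ENNReal.one_lt_top

theorem integral_of_lintegral_ofReal_eq_one {q : (Fin m → ℝ) → ℝ} (hq : Measurable q)
    (hq0 : ∀ u, 0 ≤ q u) (hq1 : ∫⁻ u, ENNReal.ofReal (q u) = 1) : ∫ u, q u = 1 := by
  rw [integral_eq_lintegral_of_nonneg_ae (Filter.Eventually.of_forall hq0)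
    hq.aestronglyMeasurable, hq1, ENNReal.toReal_one]

/-- Gibbs' identity: entropy is cross entropy minus relative entropy. -/
theorem entropy_eq {q g : (Fin m → ℝ) → ℝ} (hq : Measurable q) (hq0 : ∀ u, 0 ≤ q u)
    (hq1 : ∫⁻ u, ENNReal.ofReal (q u) = 1) (hg : Measurable g) (hg0 : ∀ u, 0 < g u)
    (hg1 : ∫⁻ u, ENNReal.ofReal (g u) = 1) (hint : Integrable fun u => q u * Real.log (g u)) :
    entropy q = ((-∫ u, q u * Real.log (g u) : ℝ) : EReal) - (relEntropy q g : EReal) := by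
  have hqi := integrable_of_lintegral_ofReal_eq_one hq hq0 hq1
  have hgi := integrable_of_lintegral_ofReal_eq_one hg (fun u => (hg0 u).le) hg1
  have hni : Integrable fun u => -(q u * Real.log (g u)) := hint.neg
  have hsi : Integrable fun u => -(q u * Real.log (g u)) - q u := hni.sub hqi
  have hh : Integrable fun u => -(q u * Real.log (g u)) - q u + g u := hsi.add hgi
  have hd : Measurable fun u => ENNReal.ofReal (g u * klFun (q u / g u)) :=
    (hg.mul (measurable_klFun.comp (hq.div hg))).ennreal_ofReal
  rw [entropy, extIntegral_sub hh hd.aemeasurable (Filter.Eventually.of_forall fun u => ?_)]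
  -- The terms `-q + g` drop out because both densities have mass one.
  · have e : ∫ u, (-(q u * Real.log (g u)) - q u + g u) = -∫ u, q u * Real.log (g u) := by
      rw [integral_add hsi hgi, integral_sub hni hqi, integral_neg,
        integral_of_lintegral_ofReal_eq_one hq hq0 hq1,
        integral_of_lintegral_ofReal_eq_one hg (fun u => (hg0 u).le) hg1]
      ring
    rw [e, relEntropy]
  · have h0 : 0 ≤ g u * klFun (q u / g u) :=
      mul_nonneg (hg0 u).le (klFun_nonneg (div_nonneg (hq0 u) (hg0 u).le))
    rw [neg_mul_log_eq (hg0 u), EReal.coe_sub, EReal.coe_ennreal_ofReal, max_eq_left h0]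

/-- On nonnegative arguments `klFun` vanishes only at `1`, so a zero integral forces `q / g = 1`
almost everywhere. Uniqueness of the optimal policy comes from here. -/
theorem ae_eq_of_relEntropy_eq_zero {q g : (Fin m → ℝ) → ℝ} (hq : Measurable q)
    (hq0 : ∀ u, 0 ≤ q u) (hg : Measurable g) (hg0 : ∀ u, 0 < g u) (h : relEntropy q g = 0) :
    q =ᵐ[volume] g := by
  have hd : Measurable fun u => ENNReal.ofReal (g u * klFun (q u / g u)) :=
    (hg.mul (measurable_klFun.comp (hq.div hg))).ennreal_ofReal
  rw [relEntropy, lintegral_eq_zero_iff hd] at h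
  filter_upwards [h] with u hu
  have h0 : 0 ≤ klFun (q u / g u) := klFun_nonneg (div_nonneg (hq0 u) (hg0 u).le)
  simp only [Pi.zero_apply, ENNReal.ofReal_eq_zero] at hu
  have h1 : klFun (q u / g u) = 0 := le_antisymm (nonpos_of_mul_nonpos_right hu (hg0 u)) h0
  rw [klFun_eq_zero_iff (div_nonneg (hq0 u) (hg0 u).le)] at h1
  exact (div_eq_one_iff_eq (hg0 u).ne').1 h1

theorem relEntropy_self {g : (Fin m → ℝ) → ℝ} (hg0 : ∀ u, 0 < g u) : relEntropy g g = 0 := by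
  simp [relEntropy, div_self (hg0 _).ne', klFun_one]

theorem measurable_relEntropy {q g : (Fin n → ℝ) → (Fin m → ℝ) → ℝ}
    (hq : Measurable fun z : (Fin n → ℝ) × (Fin m → ℝ) => q z.1 z.2)
    (hg : Measurable fun z : (Fin n → ℝ) × (Fin m → ℝ) => g z.1 z.2) :
    Measurable fun x => relEntropy (q x) (g x) := by
  have hd : Measurable fun z : (Fin n → ℝ) × (Fin m → ℝ) =>
      ENNReal.ofReal (g z.1 z.2 * klFun (q z.1 z.2 / g z.1 z.2)) :=
    (hg.mul (measurable_klFun.comp (hq.div hg))).ennreal_ofReal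
  exact hd.lintegral_prod_right'

/-- Gibbs' identity for each conditional density, averaged over the state. Fubini supplies
integrability of the cross entropy for almost every state, which suffices; the relative-entropy term
is allowed to be infinite. -/
theorem extIntegral_entropy {ρ : Measure (Fin n → ℝ)} [SFinite ρ]
    {q g : (Fin n → ℝ) → (Fin m → ℝ) → ℝ}
    (hq : Measurable fun z : (Fin n → ℝ) × (Fin m → ℝ) => q z.1 z.2) (hq0 : ∀ x u, 0 ≤ q x u)
    (hq1 : ∀ x, ∫⁻ u, ENNReal.ofReal (q x u) = 1)
    (hg : Measurable fun z : (Fin n → ℝ) × (Fin m → ℝ) => g z.1 z.2) (hg0 : ∀ x u, 0 < g x u)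
    (hg1 : ∀ x, ∫⁻ u, ENNReal.ofReal (g x u) = 1)
    (hint : Integrable (fun z => Real.log (g z.1 z.2)) (stepLaw ρ q)) :
    extIntegral ρ (fun x => entropy (q x))
      = ((-∫ z, Real.log (g z.1 z.2) ∂(stepLaw ρ q) : ℝ) : EReal)
        - ((∫⁻ x, relEntropy (q x) (g x) ∂ρ : ENNReal) : EReal) := by
  have hqm : Measurable fun z : (Fin n → ℝ) × (Fin m → ℝ) => ENNReal.ofReal (q z.1 z.2) :=
    hq.ennreal_ofReal
  have hlt : ∀ᵐ z ∂(ρ.prod volume), ENNReal.ofReal (q z.1 z.2) < ⊤ :=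
    Filter.Eventually.of_forall fun z => ENNReal.ofReal_lt_top
  have hto (z : (Fin n → ℝ) × (Fin m → ℝ)) :
      (ENNReal.ofReal (q z.1 z.2)).toReal • Real.log (g z.1 z.2)
        = q z.1 z.2 * Real.log (g z.1 z.2) := by
    rw [ENNReal.toReal_ofReal (hq0 _ _), smul_eq_mul]
  have hI : Integrable (fun z : (Fin n → ℝ) × (Fin m → ℝ) => q z.1 z.2 * Real.log (g z.1 z.2))
      (ρ.prod volume) := by
    rw [stepLaw, integrable_withDensity_iff_integrable_smul' hqm hlt] at hint
    simpa only [hto] using hint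
  have hE : ∫ z, Real.log (g z.1 z.2) ∂(stepLaw ρ q)
      = ∫ x, (∫ u, q x u * Real.log (g x u)) ∂ρ := by
    rw [stepLaw, integral_withDensity_eq_integral_toReal_smul hqm hlt]
    simp only [hto]
    exact integral_prod _ hI
  rw [extIntegral_sub (h := fun x => -∫ u, q x u * Real.log (g x u)) hI.integral_prod_left.neg
    (measurable_relEntropy hq hg).aemeasurable, integral_neg, hE]
  filter_upwards [hI.prod_right_ae] with x hx
  exact entropy_eq (hq.comp measurable_prodMk_left) (hq0 x) (hq1 x)
    (hg.comp measurable_prodMk_left) (hg0 x) (hg1 x) hx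

end Entropy

/-! ### Square-integrable vectors and their quadratic forms. -/

section SquareIntegrable

variable {Ω : Type*} [MeasurableSpace Ω] {ρ : Measure Ω} {a b : ℕ}

theorem memLp_mulVec {f : Ω → Fin a → ℝ} (hf : ∀ i, MemLp (fun ω => f ω i) 2 ρ)
    (M : Matrix (Fin b) (Fin a) ℝ) (i : Fin b) : MemLp (fun ω => (M *ᵥ f ω) i) 2 ρ := by
  simp only [mulVec, dotProduct]
  exact memLp_finsetSum _ fun s _ => (hf s).const_mul _

theorem integrable_dotProduct {f g : Ω → Fin a → ℝ} (hf : ∀ i, MemLp (fun ω => f ω i) 2 ρ)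
    (hg : ∀ i, MemLp (fun ω => g ω i) 2 ρ) : Integrable (fun ω => f ω ⬝ᵥ g ω) ρ := by
  simp only [dotProduct]
  exact integrable_finsetSum _ fun s _ => (hf s).integrable_mul (hg s)

theorem integrable_quad {f : Ω → Fin a → ℝ} (hf : ∀ i, MemLp (fun ω => f ω i) 2 ρ)
    (M : Matrix (Fin a) (Fin a) ℝ) : Integrable (fun ω => f ω ⬝ᵥ (M *ᵥ f ω)) ρ :=
  integrable_dotProduct hf (memLp_mulVec hf M)

theorem memLp_of_lintegral_dotProduct_ne_top {f : Ω → Fin a → ℝ} (hf : Measurable f)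
    (h : ∫⁻ ω, ENNReal.ofReal (f ω ⬝ᵥ f ω) ∂ρ ≠ ⊤) (i : Fin a) :
    MemLp (fun ω => f ω i) 2 ρ := by
  have hfi : Measurable fun ω => f ω i := (measurable_pi_apply i).comp hf
  rw [memLp_two_iff_integrable_sq hfi.aestronglyMeasurable]
  refine ⟨(hfi.pow_const 2).aestronglyMeasurable, ?_⟩
  rw [hasFiniteIntegral_iff_ofReal (Filter.Eventually.of_forall fun ω => sq_nonneg _)]
  refine lt_of_le_of_lt (lintegral_mono fun ω => ENNReal.ofReal_le_ofReal ?_) h.lt_top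
  rw [sq]
  exact Finset.single_le_sum (f := fun j => f ω j * f ω j) (fun j _ => mul_self_nonneg _)
    (Finset.mem_univ i)

theorem dotProduct_self_nonneg (v : Fin a → ℝ) : 0 ≤ v ⬝ᵥ v :=
  Finset.sum_nonneg fun _ _ => mul_self_nonneg _

theorem lintegral_dotProduct_eq {f : Ω → Fin a → ℝ} (hf : ∀ i, MemLp (fun ω => f ω i) 2 ρ) :
    ∫⁻ ω, ENNReal.ofReal (f ω ⬝ᵥ f ω) ∂ρ = ENNReal.ofReal (∫ ω, f ω ⬝ᵥ f ω ∂ρ) :=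
  (ofReal_integral_eq_lintegral_ofReal (integrable_dotProduct hf hf)
    (Filter.Eventually.of_forall fun ω => dotProduct_self_nonneg (f ω))).symm

end SquareIntegrable

/-! ### Laws, moments and expectations along an arbitrary policy. -/

section Dynamics

variable {n m : ℕ} {N : ℕ} {A : ℕ → Matrix (Fin n) (Fin n) ℝ} {B : ℕ → Matrix (Fin n) (Fin m) ℝ}
  {ν : Measure (Fin n → ℝ)} {p : ℕ → (Fin n → ℝ) → (Fin m → ℝ) → ℝ}

theorem map_fst_stepLaw {ρ : Measure (Fin n → ℝ)} [SFinite ρ] {q : (Fin n → ℝ) → (Fin m → ℝ) → ℝ}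
    (hq : Measurable fun z : (Fin n → ℝ) × (Fin m → ℝ) => q z.1 z.2)
    (hq1 : ∀ x, ∫⁻ u, ENNReal.ofReal (q x u) = 1) : (stepLaw ρ q).map Prod.fst = ρ := by
  refine Measure.ext_of_lintegral _ fun φ hφ => ?_
  have hφ' : Measurable fun z : (Fin n → ℝ) × (Fin m → ℝ) => φ z.1 := hφ.comp measurable_fst
  have hmul : Measurable fun z : (Fin n → ℝ) × (Fin m → ℝ) =>
      ENNReal.ofReal (q z.1 z.2) * φ z.1 := hq.ennreal_ofReal.mul hφ'
  rw [lintegral_map hφ measurable_fst, stepLaw,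
    lintegral_withDensity_eq_lintegral_mul _ hq.ennreal_ofReal hφ']
  refine (lintegral_prod _ hmul.aemeasurable).trans (lintegral_congr fun x => ?_)
  have hqx : Measurable fun u => q x u := hq.comp measurable_prodMk_left
  change ∫⁻ u, ENNReal.ofReal (q x u) * φ x = φ x
  rw [lintegral_mul_const _ hqx.ennreal_ofReal, hq1, one_mul]

theorem stepLaw_isProbabilityMeasure {ρ : Measure (Fin n → ℝ)} [IsProbabilityMeasure ρ]
    {q : (Fin n → ℝ) → (Fin m → ℝ) → ℝ}
    (hq : Measurable fun z : (Fin n → ℝ) × (Fin m → ℝ) => q z.1 z.2)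
    (hq1 : ∀ x, ∫⁻ u, ENNReal.ofReal (q x u) = 1) : IsProbabilityMeasure (stepLaw ρ q) := by
  refine ⟨?_⟩
  have h : (stepLaw ρ q).map Prod.fst Set.univ = 1 := by
    rw [map_fst_stepLaw hq hq1, measure_univ]
  rwa [Measure.map_apply measurable_fst MeasurableSet.univ, Set.preimage_univ] at h

theorem measurable_dynamics (a : Matrix (Fin n) (Fin n) ℝ) (b : Matrix (Fin n) (Fin m) ℝ) :
    Measurable fun z : (Fin n → ℝ) × (Fin m → ℝ) => a *ᵥ z.1 + b *ᵥ z.2 :=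
  ((continuous_const.matrix_mulVec continuous_fst).add
    (continuous_const.matrix_mulVec continuous_snd)).measurable

theorem stateLaw_isProbabilityMeasure [IsProbabilityMeasure ν] (hp : IsPolicy N p) {k : ℕ}
    (hk : k ≤ N) : IsProbabilityMeasure (stateLaw A B ν p k) := by
  induction k with
  | zero => assumption
  | succ k ih =>
    have := ih (by omega)
    have := stepLaw_isProbabilityMeasure (ρ := stateLaw A B ν p k) (hp.measurable k hk)
      (hp.mass_one k hk)
    exact Measure.isProbabilityMeasure_map (measurable_dynamics _ _).aemeasurable

theorem jointLaw_isProbabilityMeasure [IsProbabilityMeasure ν] (hp : IsPolicy N p) {k : ℕ}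
    (hk : k < N) : IsProbabilityMeasure (jointLaw A B ν p k) := by
  have := stateLaw_isProbabilityMeasure (A := A) (B := B) (ν := ν) hp hk.le
  exact stepLaw_isProbabilityMeasure (hp.measurable k hk) (hp.mass_one k hk)

theorem map_fst_jointLaw [IsProbabilityMeasure ν] (hp : IsPolicy N p) {k : ℕ}
    (hk : k < N) : (jointLaw A B ν p k).map Prod.fst = stateLaw A B ν p k := by
  have := stateLaw_isProbabilityMeasure (A := A) (B := B) (ν := ν) hp hk.le
  exact map_fst_stepLaw (hp.measurable k hk) (hp.mass_one k hk)

theorem control_memLp {k : ℕ} (hE : energy A B ν p k ≠ ⊤) (i : Fin m) :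
    MemLp (fun z : (Fin n → ℝ) × (Fin m → ℝ) => z.2 i) 2 (jointLaw A B ν p k) :=
  memLp_of_lintegral_dotProduct_ne_top measurable_snd hE i

theorem jointState_memLp [IsProbabilityMeasure ν] (hp : IsPolicy N p) {k : ℕ} (hk : k < N)
    (h : ∀ i, MemLp (fun x => x i) 2 (stateLaw A B ν p k)) (i : Fin n) :
    MemLp (fun z : (Fin n → ℝ) × (Fin m → ℝ) => z.1 i) 2 (jointLaw A B ν p k) :=
  (h i).comp_measurePreserving ⟨measurable_fst, map_fst_jointLaw hp hk⟩

/-- Finite energies propagate finite second moments forward through the linear dynamics, which makes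
every quadratic form in the cost computation integrable at the intermediate times. -/
theorem state_memLp [IsProbabilityMeasure ν] (hp : IsPolicy N p)
    (hν : ∀ i, MemLp (fun x : Fin n → ℝ => x i) 2 ν) (hE : ∀ k < N, energy A B ν p k ≠ ⊤)
    {k : ℕ} (hk : k ≤ N) (i : Fin n) : MemLp (fun x => x i) 2 (stateLaw A B ν p k) := by
  induction k generalizing i with
  | zero => exact hν i
  | succ k ih =>
    change MemLp _ 2 ((jointLaw A B ν p k).map _)
    rw [memLp_map_measure_iff (measurable_pi_apply i).aestronglyMeasurable
      (measurable_dynamics _ _).aemeasurable]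
    exact (memLp_mulVec (jointState_memLp hp hk (ih (by omega))) (A k) i).add
      (memLp_mulVec (control_memLp (hE k hk)) (B k) i)

/-- Expected state. -/
noncomputable def expectedState (A : ℕ → Matrix (Fin n) (Fin n) ℝ)
    (B : ℕ → Matrix (Fin n) (Fin m) ℝ) (ν : Measure (Fin n → ℝ))
    (p : ℕ → (Fin n → ℝ) → (Fin m → ℝ) → ℝ) (k : ℕ) : Fin n → ℝ :=
  fun i => ∫ x, x i ∂(stateLaw A B ν p k)

/-- Expected control. -/
noncomputable def expectedControl (A : ℕ → Matrix (Fin n) (Fin n) ℝ)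
    (B : ℕ → Matrix (Fin n) (Fin m) ℝ) (ν : Measure (Fin n → ℝ))
    (p : ℕ → (Fin n → ℝ) → (Fin m → ℝ) → ℝ) (k : ℕ) : Fin m → ℝ :=
  fun i => ∫ z, z.2 i ∂(jointLaw A B ν p k)

theorem integral_dotProduct_const {Ω : Type*} [MeasurableSpace Ω] {ρ : Measure Ω} {a : ℕ}
    {f : Ω → Fin a → ℝ} (hf : ∀ i, Integrable (fun ω => f ω i) ρ) (v : Fin a → ℝ) :
    ∫ ω, v ⬝ᵥ f ω ∂ρ = v ⬝ᵥ fun i => ∫ ω, f ω i ∂ρ := by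
  simp only [dotProduct]
  rw [integral_finsetSum _ fun i _ => (hf i).const_mul _]
  simp only [integral_const_mul]

/-- Taking expectations turns any policy into a deterministic trajectory, so that
`sum_meanInput_dotProduct` applies to it. -/
theorem expectedState_succ [IsProbabilityMeasure ν] (hp : IsPolicy N p)
    (hν : ∀ i, MemLp (fun x : Fin n → ℝ => x i) 2 ν) (hE : ∀ k < N, energy A B ν p k ≠ ⊤)
    {k : ℕ} (hk : k < N) : expectedState A B ν p (k + 1)
      = A k *ᵥ expectedState A B ν p k + B k *ᵥ expectedControl A B ν p k := by
  have := jointLaw_isProbabilityMeasure (A := A) (B := B) (ν := ν) hp hk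
  have hx := fun i => (jointState_memLp hp hk (state_memLp hp hν hE hk.le) i).integrable one_le_two
  have hu := fun i => (control_memLp (hE k hk) i).integrable one_le_two
  funext i
  have h1 : expectedState A B ν p (k + 1) i
      = ∫ z, (A k *ᵥ z.1 + B k *ᵥ z.2) i ∂(jointLaw A B ν p k) :=
    integral_map (measurable_dynamics _ _).aemeasurable
      (measurable_pi_apply i).aestronglyMeasurable
  have h2 : expectedState A B ν p k = fun i => ∫ z, z.1 i ∂(jointLaw A B ν p k) := by
    funext i
    rw [expectedState, ← map_fst_jointLaw hp hk]
    exact integral_map measurable_fst.aemeasurable (measurable_pi_apply i).aestronglyMeasurable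
  rw [h1, h2]
  simp only [Pi.add_apply]
  rw [integral_add]
  · exact congrArg₂ _ (integral_dotProduct_const hx _) (integral_dotProduct_const hu _)
  · exact (memLp_mulVec (jointState_memLp hp hk (state_memLp hp hν hE hk.le))
      (A k) i).integrable one_le_two
  · exact (memLp_mulVec (control_memLp (hE k hk)) (B k) i).integrable one_le_two

/-- The boundary terms of the telescoping sum see a law only through its mean and covariance. For
this reason the initial law may be exchanged and need not be Gaussian. -/
theorem HasMeanCov.integral_quad {ρ : Measure (Fin n → ℝ)} {c : Fin n → ℝ}
    [IsFiniteMeasure ρ]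
    {C : Matrix (Fin n) (Fin n) ℝ} (h : HasMeanCov ρ c C) (M : Matrix (Fin n) (Fin n) ℝ) :
    ∫ x, (x - c) ⬝ᵥ (M *ᵥ (x - c)) ∂ρ = ∑ i, ∑ j, M i j * C i j := by
  have hL (i : Fin n) : MemLp (fun x : Fin n → ℝ => x i - c i) 2 ρ :=
    (h.memLp i).sub (memLp_const _)
  have hint (i j : Fin n) : Integrable (fun x : Fin n → ℝ => M i j * ((x i - c i) * (x j - c j))) ρ :=
    ((hL i).integrable_mul (hL j)).const_mul _
  have e (x : Fin n → ℝ) : (x - c) ⬝ᵥ (M *ᵥ (x - c))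
      = ∑ i, ∑ j, M i j * ((x i - c i) * (x j - c j)) := by
    simp only [dotProduct, mulVec, Finset.mul_sum, Pi.sub_apply]
    exact Finset.sum_congr rfl fun i _ => Finset.sum_congr rfl fun j _ => by ring
  simp only [e]
  rw [integral_finsetSum _ fun i _ => integrable_finsetSum _ fun j _ => hint i j]
  refine Finset.sum_congr rfl fun i _ => ?_
  rw [integral_finsetSum _ fun j _ => hint i j]
  exact Finset.sum_congr rfl fun j _ => by rw [integral_const_mul, h.cov]

end Dynamics

/-! ### The candidate policy and its logarithm. -/

section OptimalPolicy

variable {n m : ℕ} {N : ℕ} {A : ℕ → Matrix (Fin n) (Fin n) ℝ} {B : ℕ → Matrix (Fin n) (Fin m) ℝ}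
  {ε : ℝ} {C₀ CN : Matrix (Fin n) (Fin n) ℝ} {μ₀ μN : Fin n → ℝ}

/-- The mean of the control under the optimal policy in the state `x`. -/
noncomputable def optMean (N : ℕ) (A : ℕ → Matrix (Fin n) (Fin n) ℝ)
    (B : ℕ → Matrix (Fin n) (Fin m) ℝ) (ε : ℝ) (C₀ CN : Matrix (Fin n) (Fin n) ℝ)
    (μ₀ μN : Fin n → ℝ) (k : ℕ) (x : Fin n → ℝ) : Fin m → ℝ :=
  -(feedbackGain N A B ε C₀ CN k *ᵥ (x - meanState N A B μ₀ μN k)) + meanInput N A B μ₀ μN k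

/-- A square root of the covariance of the control under the optimal policy. -/
noncomputable def noiseFactor (N : ℕ) (A : ℕ → Matrix (Fin n) (Fin n) ℝ)
    (B : ℕ → Matrix (Fin n) (Fin m) ℝ) (ε : ℝ) (C₀ CN : Matrix (Fin n) (Fin n) ℝ) (k : ℕ) :
    Matrix (Fin m) (Fin m) ℝ :=
  msqrt (ε • (gainWeight N A B ε C₀ CN k)⁻¹)

theorem continuous_optMean (k : ℕ) : Continuous (optMean N A B ε C₀ CN μ₀ μN k) :=
  (continuous_const.matrix_mulVec (continuous_id.sub continuous_const)).neg.add continuous_const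

theorem noiseFactor_mul_transpose (hε : 0 < ε) {k : ℕ}
    (hL : (gainWeight N A B ε C₀ CN k).PosDef) :
    noiseFactor N A B ε C₀ CN k * (noiseFactor N A B ε C₀ CN k)ᵀ
      = ε • (gainWeight N A B ε C₀ CN k)⁻¹ := by
  rw [noiseFactor, msqrt_transpose, msqrt_mul_self (hL.inv.smul hε).posSemidef]

theorem noiseFactor_det_ne_zero (hε : 0 < ε) {k : ℕ}
    (hL : (gainWeight N A B ε C₀ CN k).PosDef) : (noiseFactor N A B ε C₀ CN k).det ≠ 0 :=
  isUnit_iff_ne_zero.1 ((isUnit_iff_isUnit_det _).1 (msqrt_isUnit (hL.inv.smul hε)))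

theorem optPolicy_eq (hε : 0 < ε) {k : ℕ} (hL : (gainWeight N A B ε C₀ CN k).PosDef) :
    optPolicy N A B ε C₀ CN μ₀ μN k = fun x u => gaussianDensity (optMean N A B ε C₀ CN μ₀ μN k x)
      (noiseFactor N A B ε C₀ CN k * (noiseFactor N A B ε C₀ CN k)ᵀ) u := by
  rw [noiseFactor_mul_transpose hε hL]
  rfl

theorem measurable_optPolicy (k : ℕ) : Measurable fun z : (Fin n → ℝ) × (Fin m → ℝ) =>
    optPolicy N A B ε C₀ CN μ₀ μN k z.1 z.2 :=
  (continuous_gaussianDensity _ ((continuous_optMean k).comp continuous_fst)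
    continuous_snd).measurable

theorem optPolicy_pos (hε : 0 < ε) {k : ℕ} (hL : (gainWeight N A B ε C₀ CN k).PosDef)
    (x : Fin n → ℝ) (u : Fin m → ℝ) : 0 < optPolicy N A B ε C₀ CN μ₀ μN k x u := by
  have h := (hL.inv.smul hε).det_pos
  unfold optPolicy gaussianDensity
  positivity

theorem lintegral_optPolicy (hε : 0 < ε) {k : ℕ} (hL : (gainWeight N A B ε C₀ CN k).PosDef)
    (x : Fin n → ℝ) : ∫⁻ u, ENNReal.ofReal (optPolicy N A B ε C₀ CN μ₀ μN k x u) = 1 := by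
  rw [optPolicy_eq hε hL]
  exact lintegral_gaussianDensity (noiseFactor_det_ne_zero hε hL) _

theorem optPolicy_isPolicy (hε : 0 < ε) (hL : ∀ k < N, (gainWeight N A B ε C₀ CN k).PosDef) :
    IsPolicy N (optPolicy N A B ε C₀ CN μ₀ μN) where
  measurable k _ := measurable_optPolicy k
  nonneg k hk x u := (optPolicy_pos hε (hL k hk) x u).le
  mass_one k hk x := lintegral_optPolicy hε (hL k hk) x

/-- The logarithm of the normalizing factor of the optimal policy. -/
noncomputable def logNormalizer (N : ℕ) (A : ℕ → Matrix (Fin n) (Fin n) ℝ)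
    (B : ℕ → Matrix (Fin n) (Fin m) ℝ) (ε : ℝ) (C₀ CN : Matrix (Fin n) (Fin n) ℝ) (k : ℕ) : ℝ :=
  Real.log (Real.sqrt ((2 * Real.pi) ^ m * (ε • (gainWeight N A B ε C₀ CN k)⁻¹).det))⁻¹

/-- The covariance `ε Λ⁻¹` is chosen so that `ε` cancels in the exponent, leaving precisely the
square produced by `completion_of_squares`. -/
theorem eps_mul_log_optPolicy (hε : 0 < ε) {k : ℕ} (hL : (gainWeight N A B ε C₀ CN k).PosDef)
    (x : Fin n → ℝ) (u : Fin m → ℝ) :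
    ε * Real.log (optPolicy N A B ε C₀ CN μ₀ μN k x u) = ε * logNormalizer N A B ε C₀ CN k -
      (1 / 2) * ((u - optMean N A B ε C₀ CN μ₀ μN k x) ⬝ᵥ
        (gainWeight N A B ε C₀ CN k *ᵥ (u - optMean N A B ε C₀ CN μ₀ μN k x))) := by
  have hdet := (hL.inv.smul hε).det_pos
  have hinv : (ε • (gainWeight N A B ε C₀ CN k)⁻¹)⁻¹ = ε⁻¹ • gainWeight N A B ε C₀ CN k := by
    apply inv_eq_right_inv
    rw [Matrix.smul_mul, Matrix.mul_smul, smul_smul, mul_inv_cancel₀ hε.ne', one_smul,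
      nonsing_inv_mul _ ((isUnit_iff_isUnit_det _).1 hL.isUnit)]
  change ε * Real.log (gaussianDensity (optMean N A B ε C₀ CN μ₀ μN k x) _ u) = _
  rw [gaussianDensity, Real.log_mul (by positivity) (Real.exp_ne_zero _), Real.log_exp, hinv,
    smul_mulVec, dotProduct_smul, smul_eq_mul, ← logNormalizer]
  field_simp
  ring

end OptimalPolicy

/-! ### Feasibility of the candidate policy. -/

section ClosedLoop

variable {n m : ℕ} {N : ℕ} {A : ℕ → Matrix (Fin n) (Fin n) ℝ} {B : ℕ → Matrix (Fin n) (Fin m) ℝ}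
  {ε : ℝ} {C₀ CN : Matrix (Fin n) (Fin n) ℝ} {μ₀ μN : Fin n → ℝ} {ν : Measure (Fin n → ℝ)}

theorem jointLaw_optPolicy [IsProbabilityMeasure ν] (hε : 0 < ε)
    (hL : ∀ k < N, (gainWeight N A B ε C₀ CN k).PosDef) {k : ℕ} (hk : k < N) :
    jointLaw A B ν (optPolicy N A B ε C₀ CN μ₀ μN) k
      = ((stateLaw A B ν (optPolicy N A B ε C₀ CN μ₀ μN) k).prod (stdNormal m)).map
        (fun z => (z.1, optMean N A B ε C₀ CN μ₀ μN k z.1 + noiseFactor N A B ε C₀ CN k *ᵥ z.2)) := by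
  have := stateLaw_isProbabilityMeasure (A := A) (B := B) (ν := ν)
    (optPolicy_isPolicy (μ₀ := μ₀) (μN := μN) hε hL) hk.le
  rw [jointLaw, optPolicy_eq hε (hL k hk)]
  exact stepLaw_gaussianDensity _ (noiseFactor_det_ne_zero hε (hL k hk)) (continuous_optMean k)

theorem measurable_optControl (k : ℕ) : Measurable fun z : (Fin n → ℝ) × (Fin m → ℝ) =>
    (z.1, optMean N A B ε C₀ CN μ₀ μN k z.1 + noiseFactor N A B ε C₀ CN k *ᵥ z.2) :=
  (continuous_fst.prodMk (((continuous_optMean k).comp continuous_fst).add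
      (continuous_const.matrix_mulVec continuous_snd))).measurable

/-- The next state is an affine function of the current state and independent standard noise, so its
first two moments follow from `HasMeanCov.map_affine` for any state law. -/
theorem optPolicy_hasMeanCov_succ [IsProbabilityMeasure ν] (hA : ∀ k < N, IsUnit (A k))
    (hε : 0 < ε) (hC₀ : C₀.PosDef)
    (hCN : CN.PosDef) (hG : (ctrlGramian A B N 0).PosDef)
    (hF : IsUnit (forwardTerm (normalizedInit N A B ε C₀) (normalizedFinal N A B ε CN)))
    {k : ℕ} (hk : k < N)
    (h : HasMeanCov (stateLaw A B ν (optPolicy N A B ε C₀ CN μ₀ μN) k)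
      (meanState N A B μ₀ μN k) (closedLoopCov N A B ε C₀ CN k)) :
    HasMeanCov (stateLaw A B ν (optPolicy N A B ε C₀ CN μ₀ μN) (k + 1))
      (meanState N A B μ₀ μN (k + 1)) (closedLoopCov N A B ε C₀ CN (k + 1)) := by
  have hL : ∀ k < N, (gainWeight N A B ε C₀ CN k).PosDef :=
    fun k hk => gainWeight_posDef hA hε hC₀ hCN hG hF hk
  have := stateLaw_isProbabilityMeasure (A := A) (B := B) (ν := ν)
    (optPolicy_isPolicy (μ₀ := μ₀) (μN := μN) hε hL) hk.le
  set K := feedbackGain N A B ε C₀ CN k with hK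
  have hmap : stateLaw A B ν (optPolicy N A B ε C₀ CN μ₀ μN) (k + 1)
      = ((stateLaw A B ν (optPolicy N A B ε C₀ CN μ₀ μN) k).prod (stdNormal m)).map
        (fun z => (A k - B k * K) *ᵥ z.1 + (B k * noiseFactor N A B ε C₀ CN k) *ᵥ z.2 +
          B k *ᵥ (K *ᵥ meanState N A B μ₀ μN k + meanInput N A B μ₀ μN k)) := by
    change (jointLaw A B ν (optPolicy N A B ε C₀ CN μ₀ μN) k).map _ = _
    rw [jointLaw_optPolicy hε hL hk, Measure.map_map (measurable_dynamics _ _)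
      (measurable_optControl k)]
    congr 1
    funext z
    simp only [Function.comp_apply, optMean, ← hK, mulVec_add, mulVec_sub, mulVec_neg, sub_mulVec,
      mulVec_mulVec]
    abel
  rw [hmap]
  have key := h.map_affine (stdNormal_hasMeanCov m) (A k - B k * K)
    (B k * noiseFactor N A B ε C₀ CN k)
    (B k *ᵥ (K *ᵥ meanState N A B μ₀ μN k + meanInput N A B μ₀ μN k))
  convert key using 1
  · rw [meanState_succ hA hk, mulVec_add, sub_mulVec, mulVec_mulVec]
    abel
  · have e : B k * noiseFactor N A B ε C₀ CN k * (B k * noiseFactor N A B ε C₀ CN k)ᵀ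
        = ε • (B k * (gainWeight N A B ε C₀ CN k)⁻¹ * (B k)ᵀ) := by
      rw [transpose_mul, Matrix.mul_assoc, ← Matrix.mul_assoc (noiseFactor N A B ε C₀ CN k),
        noiseFactor_mul_transpose hε (hL k hk)]
      simp only [Matrix.smul_mul, Matrix.mul_smul, Matrix.mul_assoc]
    rw [closedLoopCov_succ hA hε hC₀ hCN hG hF hk, e]

theorem optPolicy_hasMeanCov [IsProbabilityMeasure ν] (hA : ∀ k < N, IsUnit (A k))
    (hε : 0 < ε) (hC₀ : C₀.PosDef)
    (hCN : CN.PosDef) (hG : (ctrlGramian A B N 0).PosDef)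
    (hF : IsUnit (forwardTerm (normalizedInit N A B ε C₀) (normalizedFinal N A B ε CN)))
    (hν : HasMeanCov ν μ₀ C₀) {k : ℕ} (hk : k ≤ N) :
    HasMeanCov (stateLaw A B ν (optPolicy N A B ε C₀ CN μ₀ μN) k)
      (meanState N A B μ₀ μN k) (closedLoopCov N A B ε C₀ CN k) := by
  induction k with
  | zero =>
    rw [meanState_zero, closedLoopCov_zero (qMinusInit_isUnit hε hC₀ hG hF)]
    exact hν
  | succ k ih => exact optPolicy_hasMeanCov_succ hA hε hC₀ hCN hG hF hk (ih (by omega))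

theorem energy_optPolicy_ne_top [IsProbabilityMeasure ν] (hA : ∀ k < N, IsUnit (A k))
    (hε : 0 < ε) (hC₀ : C₀.PosDef)
    (hCN : CN.PosDef) (hG : (ctrlGramian A B N 0).PosDef)
    (hF : IsUnit (forwardTerm (normalizedInit N A B ε C₀) (normalizedFinal N A B ε CN)))
    (hν : HasMeanCov ν μ₀ C₀) {k : ℕ} (hk : k < N) :
    energy A B ν (optPolicy N A B ε C₀ CN μ₀ μN) k ≠ ⊤ := by
  have hL : ∀ k < N, (gainWeight N A B ε C₀ CN k).PosDef :=
    fun k hk => gainWeight_posDef hA hε hC₀ hCN hG hF hk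
  have := stateLaw_isProbabilityMeasure (A := A) (B := B) (ν := ν)
    (optPolicy_isPolicy (μ₀ := μ₀) (μN := μN) hε hL) hk.le
  have h := optPolicy_hasMeanCov (μN := μN) hA hε hC₀ hCN hG hF hν hk.le
  have hmem (i : Fin m) : MemLp (fun z : (Fin n → ℝ) × (Fin m → ℝ) => z.2 i) 2
      (jointLaw A B ν (optPolicy N A B ε C₀ CN μ₀ μN) k) := by
    rw [jointLaw_optPolicy hε hL hk, memLp_map_measure_iff (by fun_prop)
      (measurable_optControl k).aemeasurable]
    have h1 (j : Fin n) : MemLp (fun z : (Fin n → ℝ) × (Fin m → ℝ) =>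
        (z.1 - meanState N A B μ₀ μN k) j) 2
        ((stateLaw A B ν (optPolicy N A B ε C₀ CN μ₀ μN) k).prod (stdNormal m)) :=
      ((h.memLp j).sub (memLp_const (meanState N A B μ₀ μN k j))).comp_measurePreserving
        measurePreserving_fst
    have h2 (j : Fin m) : MemLp (fun z : (Fin n → ℝ) × (Fin m → ℝ) => z.2 j) 2
        ((stateLaw A B ν (optPolicy N A B ε C₀ CN μ₀ μN) k).prod (stdNormal m)) :=
      ((stdNormal_hasMeanCov m).memLp j).comp_measurePreserving measurePreserving_snd
    have h3 : MemLp (fun _ : (Fin n → ℝ) × (Fin m → ℝ) => meanInput N A B μ₀ μN k i) 2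
        ((stateLaw A B ν (optPolicy N A B ε C₀ CN μ₀ μN) k).prod (stdNormal m)) := memLp_const _
    exact ((memLp_mulVec h1 (feedbackGain N A B ε C₀ CN k) i).neg.add h3).add
      (memLp_mulVec h2 (noiseFactor N A B ε C₀ CN k) i)
  rw [energy, lintegral_dotProduct_eq hmem]
  exact ENNReal.ofReal_ne_top

theorem optPolicy_isFeasible (hA : ∀ k < N, IsUnit (A k))
    (hε : 0 < ε) (hC₀ : C₀.PosDef)
    (hCN : CN.PosDef) (hGr : IsUnit (reachGramian A B N 0))
    (hF : IsUnit (forwardTerm (normalizedInit N A B ε C₀) (normalizedFinal N A B ε CN)))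
    (hprob : IsProbabilityMeasure ν) (hν : HasMeanCov ν μ₀ C₀) :
    IsFeasible N A B μ₀ μN C₀ CN ν (optPolicy N A B ε C₀ CN μ₀ μN) where
  prob := hprob
  policy := optPolicy_isPolicy hε fun _ hk =>
    gainWeight_posDef hA hε hC₀ hCN (ctrlGramian_posDef hA hGr) hF hk
  initial := hν
  final := by
    have h := optPolicy_hasMeanCov (μN := μN) hA hε hC₀ hCN (ctrlGramian_posDef hA hGr) hF hν le_rfl
    rwa [meanState_final hGr, closedLoopCov_final hA hε hC₀ hCN (ctrlGramian_posDef hA hGr) hF]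
      at h

end ClosedLoop

/-! ### The exact cost formula. -/

section Cost

variable {n m : ℕ} {N : ℕ} {A : ℕ → Matrix (Fin n) (Fin n) ℝ} {B : ℕ → Matrix (Fin n) (Fin m) ℝ}
  {ε : ℝ} {C₀ CN : Matrix (Fin n) (Fin n) ℝ} {μ₀ μN : Fin n → ℝ} {ν : Measure (Fin n → ℝ)}
  {p : ℕ → (Fin n → ℝ) → (Fin m → ℝ) → ℝ}

/-- The expected value `E[(x_k - μ_k)ᵀ Q_k⁻¹ (x_k - μ_k)]`. -/
noncomputable def expectedValue (N : ℕ) (A : ℕ → Matrix (Fin n) (Fin n) ℝ)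
    (B : ℕ → Matrix (Fin n) (Fin m) ℝ) (ε : ℝ) (C₀ CN : Matrix (Fin n) (Fin n) ℝ)
    (μ₀ μN : Fin n → ℝ) (ν : Measure (Fin n → ℝ)) (p : ℕ → (Fin n → ℝ) → (Fin m → ℝ) → ℝ)
    (k : ℕ) : ℝ :=
  ∫ x, (x - meanState N A B μ₀ μN k) ⬝ᵥ
    ((qMinus N A B ε C₀ CN k)⁻¹ *ᵥ (x - meanState N A B μ₀ μN k)) ∂(stateLaw A B ν p k)

theorem integral_const_add_add_sub {Ω : Type*} [MeasurableSpace Ω] {ρ : Measure Ω}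
    [IsProbabilityMeasure ρ] {f g h : Ω → ℝ} (hf : Integrable f ρ) (hg : Integrable g ρ)
    (hh : Integrable h ρ) (c : ℝ) :
    ∫ ω, (c + f ω + g ω - h ω) ∂ρ = c + ∫ ω, f ω ∂ρ + ∫ ω, g ω ∂ρ - ∫ ω, h ω ∂ρ := by
  have h1 : Integrable (fun ω => c + f ω) ρ := (integrable_const c).add hf
  have h2 : Integrable (fun ω => c + f ω + g ω) ρ := h1.add hg
  rw [integral_sub h2 hh, integral_add h1 hg, integral_add (integrable_const c) hf]
  simp

/-- The running cost in terms of the value function. -/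
theorem runningCost_eq (hA : ∀ k < N, IsUnit (A k)) (hε : 0 < ε) (hC₀ : C₀.PosDef)
    (hCN : CN.PosDef) (hG : (ctrlGramian A B N 0).PosDef)
    (hF : IsUnit (forwardTerm (normalizedInit N A B ε C₀) (normalizedFinal N A B ε CN)))
    {k : ℕ} (hk : k < N) (x : Fin n → ℝ) (u : Fin m → ℝ) :
    (1 / 2) * (u ⬝ᵥ u) + ε * Real.log (optPolicy N A B ε C₀ CN μ₀ μN k x u)
      = (ε * logNormalizer N A B ε C₀ CN k
          - (1 / 2) * (meanInput N A B μ₀ μN k ⬝ᵥ meanInput N A B μ₀ μN k))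
        + meanInput N A B μ₀ μN k ⬝ᵥ u
        + (1 / 2) * ((x - meanState N A B μ₀ μN k) ⬝ᵥ
            ((qMinus N A B ε C₀ CN k)⁻¹ *ᵥ (x - meanState N A B μ₀ μN k)))
        - (1 / 2) * ((A k *ᵥ x + B k *ᵥ u - meanState N A B μ₀ μN (k + 1)) ⬝ᵥ
            ((qMinus N A B ε C₀ CN (k + 1))⁻¹ *ᵥ
              (A k *ᵥ x + B k *ᵥ u - meanState N A B μ₀ μN (k + 1)))) := by
  have hL := gainWeight_posDef hA hε hC₀ hCN hG hF hk
  -- The square is completed in the deviations from the mean trajectory. Expanding `‖u - ū*_k‖²`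
  -- then leaves the linear term `ū*_k · u`.
  have key := completion_of_squares (K := feedbackGain N A B ε C₀ CN k) (hA k hk)
    (qMinus_isUnit hA hε hC₀ hCN hG hF hk.le) (qMinus_isUnit hA hε hC₀ hCN hG hF hk)
    (qMinus_transpose hε hC₀ hG (k + 1)) rfl hL.isUnit rfl rfl
    (x - meanState N A B μ₀ μN k) (u - meanInput N A B μ₀ μN k)
  have e1 : A k *ᵥ (x - meanState N A B μ₀ μN k) + B k *ᵥ (u - meanInput N A B μ₀ μN k)
      = A k *ᵥ x + B k *ᵥ u - meanState N A B μ₀ μN (k + 1) := by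
    rw [meanState_succ hA hk, mulVec_sub, mulVec_sub]
    abel
  have e2 : u - meanInput N A B μ₀ μN k +
      feedbackGain N A B ε C₀ CN k *ᵥ (x - meanState N A B μ₀ μN k)
      = u - optMean N A B ε C₀ CN μ₀ μN k x := by
    rw [optMean]; abel
  rw [e1, e2] at key
  have e3 : (u - meanInput N A B μ₀ μN k) ⬝ᵥ (u - meanInput N A B μ₀ μN k)
      = u ⬝ᵥ u - 2 * (meanInput N A B μ₀ μN k ⬝ᵥ u)
        + meanInput N A B μ₀ μN k ⬝ᵥ meanInput N A B μ₀ μN k := by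
    rw [sub_dotProduct, dotProduct_sub, dotProduct_sub, dotProduct_comm u (meanInput N A B μ₀ μN k)]
    ring
  rw [e3] at key
  rw [eps_mul_log_optPolicy hε hL]
  linarith

theorem integrable_log_optPolicy [IsProbabilityMeasure ν] (hp : IsPolicy N p) (hε : 0 < ε)
    (hν : ∀ i, MemLp (fun x : Fin n → ℝ => x i) 2 ν) (hE : ∀ k < N, energy A B ν p k ≠ ⊤)
    {k : ℕ} (hk : k < N) (hL : (gainWeight N A B ε C₀ CN k).PosDef) :
    Integrable (fun z : (Fin n → ℝ) × (Fin m → ℝ) =>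
      Real.log (optPolicy N A B ε C₀ CN μ₀ μN k z.1 z.2)) (jointLaw A B ν p k) := by
  have := jointLaw_isProbabilityMeasure (A := A) (B := B) (ν := ν) hp hk
  have hx := jointState_memLp hp hk (state_memLp hp hν hE hk.le)
  have hu := control_memLp (hE k hk)
  have hx' (j : Fin n) : MemLp (fun z : (Fin n → ℝ) × (Fin m → ℝ) =>
      (z.1 - meanState N A B μ₀ μN k) j) 2 (jointLaw A B ν p k) :=
    (hx j).sub (memLp_const (meanState N A B μ₀ μN k j))
  have hc (j : Fin m) : MemLp (fun _ : (Fin n → ℝ) × (Fin m → ℝ) => meanInput N A B μ₀ μN k j) 2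
      (jointLaw A B ν p k) := memLp_const _
  have hd (j : Fin m) : MemLp (fun z : (Fin n → ℝ) × (Fin m → ℝ) =>
      (z.2 - optMean N A B ε C₀ CN μ₀ μN k z.1) j) 2 (jointLaw A B ν p k) :=
    (hu j).sub ((memLp_mulVec hx' (feedbackGain N A B ε C₀ CN k) j).neg.add (hc j))
  have hq := (integrable_quad hd (gainWeight N A B ε C₀ CN k)).const_mul (1 / 2)
  have hI := (((integrable_const (ε * logNormalizer N A B ε C₀ CN k)).sub hq).const_mul ε⁻¹)
  refine hI.congr (Filter.Eventually.of_forall fun z => ?_)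
  have h := eps_mul_log_optPolicy (μ₀ := μ₀) (μN := μN) hε hL z.1 z.2
  change ε⁻¹ * (_ - _) = _
  rw [← h, inv_mul_cancel_left₀ hε.ne']

theorem integral_runningCost [IsProbabilityMeasure ν] (hA : ∀ k < N, IsUnit (A k)) (hε : 0 < ε)
    (hC₀ : C₀.PosDef) (hCN : CN.PosDef) (hG : (ctrlGramian A B N 0).PosDef)
    (hF : IsUnit (forwardTerm (normalizedInit N A B ε C₀) (normalizedFinal N A B ε CN)))
    (hp : IsPolicy N p)
    (hν : ∀ i, MemLp (fun x : Fin n → ℝ => x i) 2 ν) (hE : ∀ k < N, energy A B ν p k ≠ ⊤)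
    {k : ℕ} (hk : k < N) :
    (1 / 2) * ∫ z, z.2 ⬝ᵥ z.2 ∂(jointLaw A B ν p k) +
        ε * ∫ z, Real.log (optPolicy N A B ε C₀ CN μ₀ μN k z.1 z.2) ∂(jointLaw A B ν p k)
      = (ε * logNormalizer N A B ε C₀ CN k
          - (1 / 2) * (meanInput N A B μ₀ μN k ⬝ᵥ meanInput N A B μ₀ μN k))
        + meanInput N A B μ₀ μN k ⬝ᵥ expectedControl A B ν p k
        + (1 / 2) * expectedValue N A B ε C₀ CN μ₀ μN ν p k
        - (1 / 2) * expectedValue N A B ε C₀ CN μ₀ μN ν p (k + 1) := by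
  have := jointLaw_isProbabilityMeasure (A := A) (B := B) (ν := ν) hp hk
  have hL := gainWeight_posDef hA hε hC₀ hCN hG hF hk
  have hx := jointState_memLp hp hk (state_memLp hp hν hE hk.le)
  have hu := control_memLp (hE k hk)
  have hx' (j : Fin n) : MemLp (fun z : (Fin n → ℝ) × (Fin m → ℝ) =>
      (z.1 - meanState N A B μ₀ μN k) j) 2 (jointLaw A B ν p k) :=
    (hx j).sub (memLp_const (meanState N A B μ₀ μN k j))
  have hy (j : Fin n) : MemLp (fun z : (Fin n → ℝ) × (Fin m → ℝ) =>
      (A k *ᵥ z.1 + B k *ᵥ z.2 - meanState N A B μ₀ μN (k + 1)) j) 2 (jointLaw A B ν p k) :=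
    ((memLp_mulVec hx (A k) j).add (memLp_mulVec hu (B k) j)).sub
      (memLp_const (meanState N A B μ₀ μN (k + 1) j))
  have hc (j : Fin m) : MemLp (fun _ : (Fin n → ℝ) × (Fin m → ℝ) => meanInput N A B μ₀ μN k j) 2
      (jointLaw A B ν p k) := memLp_const _
  have I1 := (integrable_dotProduct hu hu).const_mul (1 / 2)
  have I2 := (integrable_log_optPolicy (μ₀ := μ₀) (μN := μN) hp hε hν hE hk hL).const_mul ε
  have J2 := integrable_dotProduct hc hu
  have J3 := (integrable_quad hx' (qMinus N A B ε C₀ CN k)⁻¹).const_mul (1 / 2)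
  have J4 := (integrable_quad hy (qMinus N A B ε C₀ CN (k + 1))⁻¹).const_mul (1 / 2)
  have V0 : ∫ z, (z.1 - meanState N A B μ₀ μN k) ⬝ᵥ
      ((qMinus N A B ε C₀ CN k)⁻¹ *ᵥ (z.1 - meanState N A B μ₀ μN k)) ∂(jointLaw A B ν p k)
      = expectedValue N A B ε C₀ CN μ₀ μN ν p k := by
    rw [expectedValue, ← map_fst_jointLaw hp hk, integral_map measurable_fst.aemeasurable]
    have hc : Continuous fun x => x - meanState N A B μ₀ μN k := continuous_id.sub continuous_const
    exact (hc.dotProduct (continuous_const.matrix_mulVec hc)).aestronglyMeasurable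
  have V1 : ∫ z, (A k *ᵥ z.1 + B k *ᵥ z.2 - meanState N A B μ₀ μN (k + 1)) ⬝ᵥ
      ((qMinus N A B ε C₀ CN (k + 1))⁻¹ *ᵥ
        (A k *ᵥ z.1 + B k *ᵥ z.2 - meanState N A B μ₀ μN (k + 1))) ∂(jointLaw A B ν p k)
      = expectedValue N A B ε C₀ CN μ₀ μN ν p (k + 1) := by
    have hc : Continuous fun x => x - meanState N A B μ₀ μN (k + 1) :=
      continuous_id.sub continuous_const
    exact (integral_map (measurable_dynamics _ _).aemeasurable
      (hc.dotProduct (continuous_const.matrix_mulVec hc)).aestronglyMeasurable).symm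
  have V2 := integral_dotProduct_const (fun i => (hu i).integrable one_le_two)
    (meanInput N A B μ₀ μN k)
  rw [← integral_const_mul, ← integral_const_mul, ← integral_add I1 I2]
  simp only [runningCost_eq hA hε hC₀ hCN hG hF hk]
  rw [integral_const_add_add_sub J2 J3 J4, integral_const_mul, integral_const_mul, V0, V1, V2]
  rfl

/-- The optimal value of the problem. -/
noncomputable def optValue (N : ℕ) (A : ℕ → Matrix (Fin n) (Fin n) ℝ)
    (B : ℕ → Matrix (Fin n) (Fin m) ℝ) (ε : ℝ) (C₀ CN : Matrix (Fin n) (Fin n) ℝ)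
    (μ₀ μN : Fin n → ℝ) : ℝ :=
  ∑ k ∈ Finset.range N, (ε * logNormalizer N A B ε C₀ CN k
      - (1 / 2) * (meanInput N A B μ₀ μN k ⬝ᵥ meanInput N A B μ₀ μN k)) +
    ((reachGramian A B N 0)⁻¹ *ᵥ (μN - transition A N 0 *ᵥ μ₀)) ⬝ᵥ (μN - transition A N 0 *ᵥ μ₀) +
    (1 / 2) * (∑ i, ∑ j, (qMinus N A B ε C₀ CN 0)⁻¹ i j * C₀ i j) -
    (1 / 2) * (∑ i, ∑ j, (qMinus N A B ε C₀ CN N)⁻¹ i j * CN i j)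

/-- The value terms telescope to times `0` and `N`, where the constraints fix them; the terms linear
in the control are fixed by the endpoint means. Hence the total is the same for all feasible
policies of finite energy. -/
theorem sum_integral_runningCost (hA : ∀ k < N, IsUnit (A k)) (hε : 0 < ε)
    (hC₀ : C₀.PosDef) (hCN : CN.PosDef) (hGr : IsUnit (reachGramian A B N 0))
    (hF : IsUnit (forwardTerm (normalizedInit N A B ε C₀) (normalizedFinal N A B ε CN)))
    (hf : IsFeasible N A B μ₀ μN C₀ CN ν p) (hE : ∀ k < N, energy A B ν p k ≠ ⊤) :
    ∑ k ∈ Finset.range N, ((1 / 2) * ∫ z, z.2 ⬝ᵥ z.2 ∂(jointLaw A B ν p k) +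
        ε * ∫ z, Real.log (optPolicy N A B ε C₀ CN μ₀ μN k z.1 z.2) ∂(jointLaw A B ν p k))
      = optValue N A B ε C₀ CN μ₀ μN := by
  have := hf.prob
  have := stateLaw_isProbabilityMeasure (A := A) (B := B) (ν := ν) hf.policy le_rfl
  have hG := ctrlGramian_posDef hA hGr
  rw [Finset.sum_congr rfl fun k hk => integral_runningCost hA hε hC₀ hCN hG hF hf.policy
    hf.initial.memLp hE (Finset.mem_range.1 hk)]
  have h0 : expectedValue N A B ε C₀ CN μ₀ μN ν p 0
      = ∑ i, ∑ j, (qMinus N A B ε C₀ CN 0)⁻¹ i j * C₀ i j := by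
    rw [expectedValue, meanState_zero]
    exact hf.initial.integral_quad _
  have h1 : expectedValue N A B ε C₀ CN μ₀ μN ν p N
      = ∑ i, ∑ j, (qMinus N A B ε C₀ CN N)⁻¹ i j * CN i j := by
    rw [expectedValue, meanState_final hGr]
    exact hf.final.integral_quad _
  have h2 : expectedState A B ν p 0 = μ₀ := funext hf.initial.mean
  have h3 : expectedState A B ν p N = μN := funext hf.final.mean
  have h4 := sum_meanInput_dotProduct (μ₀ := μ₀) (μN := μN) hA
    (y := expectedState A B ν p) (w := expectedControl A B ν p)
    fun k hk => expectedState_succ hf.policy hf.initial.memLp hE hk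
  have h5 := Finset.sum_range_sub' (expectedValue N A B ε C₀ CN μ₀ μN ν p) N
  rw [h2, h3] at h4
  rw [optValue, ← h0, ← h1, ← h4, add_sub_assoc, ← mul_sub, ← h5, Finset.mul_sum,
    ← Finset.sum_add_distrib, ← Finset.sum_add_distrib]
  exact Finset.sum_congr rfl fun k _ => by ring

/-- The accumulated relative entropy of a policy with respect to the optimal policy. -/
noncomputable def totalRelEntropy (N : ℕ) (A : ℕ → Matrix (Fin n) (Fin n) ℝ)
    (B : ℕ → Matrix (Fin n) (Fin m) ℝ) (ε : ℝ) (C₀ CN : Matrix (Fin n) (Fin n) ℝ)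
    (μ₀ μN : Fin n → ℝ) (ν : Measure (Fin n → ℝ)) (p : ℕ → (Fin n → ℝ) → (Fin m → ℝ) → ℝ) :
    ENNReal :=
  ∑ k ∈ Finset.range N, ENNReal.ofReal ε *
    ∫⁻ x, relEntropy (p k x) (optPolicy N A B ε C₀ CN μ₀ μN k x) ∂(stateLaw A B ν p k)

/-- Here `d` is the expected relative entropy. If it is infinite, the entropy is `⊥` and both sides
are `⊤`. -/
theorem ereal_stage_eq {a b : ℝ} (hε : 0 < ε) (ha : 0 ≤ a) (d : ENNReal) :
    ((ENNReal.ofReal a / 2 : ENNReal) : EReal) - (ε : EReal) * (((-b : ℝ) : EReal) - (d : EReal))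
      = (((1 / 2) * a + ε * b : ℝ) : EReal) + ((ENNReal.ofReal ε * d : ENNReal) : EReal) := by
  have h1 : ((ENNReal.ofReal a / 2 : ENNReal) : EReal) = ((a / 2 : ℝ) : EReal) := by
    rw [show (2 : ENNReal) = ENNReal.ofReal 2 by simp, ← ENNReal.ofReal_div_of_pos two_pos,
      EReal.coe_ennreal_ofReal, max_eq_left (by positivity)]
  rw [h1]
  by_cases hd : d = ⊤
  · subst hd
    rw [ENNReal.mul_top (by simpa using hε), EReal.coe_ennreal_top, EReal.sub_top,
      EReal.coe_mul_bot_of_pos hε, EReal.coe_add_top, EReal.sub_bot (EReal.coe_ne_bot _)]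
  · lift d to NNReal using hd
    rw [← ENNReal.ofReal_coe_nnreal (p := d), ← ENNReal.ofReal_mul hε.le,
      EReal.coe_ennreal_ofReal, EReal.coe_ennreal_ofReal, max_eq_left d.coe_nonneg,
      max_eq_left (by positivity), ← EReal.coe_sub, ← EReal.coe_mul, ← EReal.coe_sub,
      ← EReal.coe_add, EReal.coe_eq_coe_iff]
    ring

theorem ereal_sum_add (s : Finset ℕ) (a : ℕ → ℝ) (d : ℕ → ENNReal) :
    ∑ k ∈ s, ((a k : EReal) + (d k : EReal))
      = ((∑ k ∈ s, a k : ℝ) : EReal) + ((∑ k ∈ s, d k : ENNReal) : EReal) := by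
  induction s using Finset.cons_induction with
  | empty => simp
  | cons k s hk ih =>
    rw [Finset.sum_cons, Finset.sum_cons, Finset.sum_cons, ih, EReal.coe_add, EReal.coe_ennreal_add]
    exact add_add_add_comm _ _ _ _

theorem expectedEntropy_eq [IsProbabilityMeasure ν] (hε : 0 < ε) (hp : IsPolicy N p)
    (hν : ∀ i, MemLp (fun x : Fin n → ℝ => x i) 2 ν) (hE : ∀ k < N, energy A B ν p k ≠ ⊤)
    {k : ℕ} (hk : k < N) (hL : (gainWeight N A B ε C₀ CN k).PosDef) :
    expectedEntropy A B ν p k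
      = ((-∫ z, Real.log (optPolicy N A B ε C₀ CN μ₀ μN k z.1 z.2) ∂(jointLaw A B ν p k) : ℝ) :
          EReal)
        - ((∫⁻ x, relEntropy (p k x) (optPolicy N A B ε C₀ CN μ₀ μN k x) ∂(stateLaw A B ν p k) :
          ENNReal) : EReal) := by
  have := stateLaw_isProbabilityMeasure (A := A) (B := B) (ν := ν) hp hk.le
  have hg := measurable_optPolicy (N := N) (A := A) (B := B) (ε := ε) (C₀ := C₀) (CN := CN)
    (μ₀ := μ₀) (μN := μN) k
  have hg0 := optPolicy_pos (μ₀ := μ₀) (μN := μN) hε hL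
  have hg1 := lintegral_optPolicy (μ₀ := μ₀) (μN := μN) hε hL
  have hI := integrable_log_optPolicy (μ₀ := μ₀) (μN := μN) hp hε hν hE hk hL
  generalize optPolicy N A B ε C₀ CN μ₀ μN k = g at *
  exact extIntegral_entropy (hp.measurable k hk) (hp.nonneg k hk) (hp.mass_one k hk) hg hg0 hg1 hI

/-- The cost of a feasible policy with finite energy exceeds the optimal value by the accumulated
relative entropy. -/
theorem cost_eq (hA : ∀ k < N, IsUnit (A k)) (hε : 0 < ε)
    (hC₀ : C₀.PosDef) (hCN : CN.PosDef) (hGr : IsUnit (reachGramian A B N 0))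
    (hF : IsUnit (forwardTerm (normalizedInit N A B ε C₀) (normalizedFinal N A B ε CN)))
    (hf : IsFeasible N A B μ₀ μN C₀ CN ν p) (hE : ∀ k < N, energy A B ν p k ≠ ⊤) :
    cost N A B ε ν p = (optValue N A B ε C₀ CN μ₀ μN : EReal) +
      (totalRelEntropy N A B ε C₀ CN μ₀ μN ν p : EReal) := by
  have := hf.prob
  have hstage (k : ℕ) (hk : k < N) :
      ((energy A B ν p k / 2 : ENNReal) : EReal) - (ε : EReal) * expectedEntropy A B ν p k
      = (((1 / 2) * ∫ z, z.2 ⬝ᵥ z.2 ∂(jointLaw A B ν p k) +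
          ε * ∫ z, Real.log (optPolicy N A B ε C₀ CN μ₀ μN k z.1 z.2) ∂(jointLaw A B ν p k) : ℝ) :
          EReal) + ((ENNReal.ofReal ε * ∫⁻ x, relEntropy (p k x)
            (optPolicy N A B ε C₀ CN μ₀ μN k x) ∂(stateLaw A B ν p k) : ENNReal) : EReal) := by
    have hL := gainWeight_posDef hA hε hC₀ hCN (ctrlGramian_posDef hA hGr) hF hk
    have he : energy A B ν p k = ENNReal.ofReal (∫ z, z.2 ⬝ᵥ z.2 ∂(jointLaw A B ν p k)) :=
      lintegral_dotProduct_eq (control_memLp (hE k hk))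
    have h0 : 0 ≤ ∫ z, z.2 ⬝ᵥ z.2 ∂(jointLaw A B ν p k) :=
      integral_nonneg fun z => dotProduct_self_nonneg z.2
    rw [expectedEntropy_eq (μ₀ := μ₀) (μN := μN) hε hf.policy hf.initial.memLp hE hk hL, he]
    exact ereal_stage_eq hε h0 _
  have hsum := sum_integral_runningCost hA hε hC₀ hCN hGr hF hf hE
  rw [cost, if_pos hE, ← hsum, totalRelEntropy,
    Finset.sum_congr rfl fun k hk => hstage k (Finset.mem_range.1 hk)]
  exact ereal_sum_add _ _ _

theorem totalRelEntropy_optPolicy (hε : 0 < ε)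
    (hL : ∀ k < N, (gainWeight N A B ε C₀ CN k).PosDef) :
    totalRelEntropy N A B ε C₀ CN μ₀ μN ν (optPolicy N A B ε C₀ CN μ₀ μN) = 0 := by
  refine Finset.sum_eq_zero fun k hk => ?_
  simp [relEntropy_self (optPolicy_pos hε (hL k (Finset.mem_range.1 hk)) _)]

theorem ae_eq_of_lintegral_relEntropy_eq_zero {ρ : Measure (Fin n → ℝ)}
    {q g : (Fin n → ℝ) → (Fin m → ℝ) → ℝ}
    (hq : Measurable fun z : (Fin n → ℝ) × (Fin m → ℝ) => q z.1 z.2) (hq0 : ∀ x u, 0 ≤ q x u)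
    (hg : Measurable fun z : (Fin n → ℝ) × (Fin m → ℝ) => g z.1 z.2) (hg0 : ∀ x u, 0 < g x u)
    (h : ∫⁻ x, relEntropy (q x) (g x) ∂ρ = 0) : ∀ᵐ x ∂ρ, q x =ᵐ[volume] g x := by
  rw [lintegral_eq_zero_iff (measurable_relEntropy hq hg)] at h
  filter_upwards [h] with x hx
  exact ae_eq_of_relEntropy_eq_zero (hq.comp measurable_prodMk_left) (hq0 x)
    (hg.comp measurable_prodMk_left) (hg0 x) hx

theorem ae_eq_optPolicy_of_totalRelEntropy_eq_zero (hε : 0 < ε)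
    (hL : ∀ k < N, (gainWeight N A B ε C₀ CN k).PosDef) (hp : IsPolicy N p)
    (h : totalRelEntropy N A B ε C₀ CN μ₀ μN ν p = 0) {k : ℕ} (hk : k < N) :
    ∀ᵐ x ∂(stateLaw A B ν p k), p k x =ᵐ[volume] optPolicy N A B ε C₀ CN μ₀ μN k x := by
  have h1 := (Finset.sum_eq_zero_iff.1 h) k (Finset.mem_range.2 hk)
  rw [mul_eq_zero, or_iff_right (by simpa using hε)] at h1
  exact ae_eq_of_lintegral_relEntropy_eq_zero (g := optPolicy N A B ε C₀ CN μ₀ μN k)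
    (hp.measurable k hk) (hp.nonneg k hk) (measurable_optPolicy k) (optPolicy_pos hε (hL k hk)) h1

end Cost

end MaxEntSteering

/-! ### Optimality and uniqueness. -/

theorem corollary2 {n m : ℕ} (N : ℕ) (hN : 0 < N)
    (A : ℕ → Matrix (Fin n) (Fin n) ℝ) (B : ℕ → Matrix (Fin n) (Fin m) ℝ)
    (ε : ℝ) (hε : 0 < ε)
    (μ₀ μN : Fin n → ℝ) (C₀ CN : Matrix (Fin n) (Fin n) ℝ) (hC₀ : C₀.PosDef) (hCN : CN.PosDef)
    (hA : ∀ k < N, IsUnit (A k))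
    (hG : ∃ kr, 1 ≤ kr ∧ kr ≤ N ∧
      (∀ k, kr ≤ k → k ≤ N → IsUnit (MaxEntSteering.reachGramian A B k 0)) ∧
      (∀ k < kr, IsUnit (MaxEntSteering.reachGramian A B N k)))
    (hF : IsUnit (MaxEntSteering.forwardTerm
      (MaxEntSteering.normalizedInit N A B ε C₀) (MaxEntSteering.normalizedFinal N A B ε CN)))
    (hB : IsUnit (MaxEntSteering.backwardTerm
      (MaxEntSteering.normalizedInit N A B ε C₀) (MaxEntSteering.normalizedFinal N A B ε CN))) :
    -- the matrices that are inverted in the policy are invertible, its covariances are positive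
    (∀ k ≤ N, IsUnit (MaxEntSteering.qMinus N A B ε C₀ CN k)) ∧
    (∀ k < N, (MaxEntSteering.gainWeight N A B ε C₀ CN k).PosDef) ∧
    -- for every initial law with the prescribed mean and covariance, the policy is feasible,
    -- optimal, and the only optimal one
    ∀ ν₀ : MeasureTheory.Measure (Fin n → ℝ), MeasureTheory.IsProbabilityMeasure ν₀ →
      MaxEntSteering.HasMeanCov ν₀ μ₀ C₀ →
      MaxEntSteering.IsFeasible N A B μ₀ μN C₀ CN ν₀
        (MaxEntSteering.optPolicy N A B ε C₀ CN μ₀ μN) ∧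
      ∀ (ν : MeasureTheory.Measure (Fin n → ℝ)) (p : ℕ → (Fin n → ℝ) → (Fin m → ℝ) → ℝ),
        MaxEntSteering.IsFeasible N A B μ₀ μN C₀ CN ν p →
        MaxEntSteering.cost N A B ε ν₀ (MaxEntSteering.optPolicy N A B ε C₀ CN μ₀ μN) ≤
          MaxEntSteering.cost N A B ε ν p ∧
        (MaxEntSteering.cost N A B ε ν p ≤
            MaxEntSteering.cost N A B ε ν₀ (MaxEntSteering.optPolicy N A B ε C₀ CN μ₀ μN) →
          ∀ k < N, ∀ᵐ x ∂(MaxEntSteering.stateLaw A B ν p k),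
            p k x =ᵐ[MeasureTheory.volume]
              MaxEntSteering.optPolicy N A B ε C₀ CN μ₀ μN k x) := by
  obtain ⟨kr, -, hkr, hreach, -⟩ := hG
  have hGr : IsUnit (MaxEntSteering.reachGramian A B N 0) := hreach N hkr le_rfl
  have hGc := MaxEntSteering.ctrlGramian_posDef hA hGr
  have hL : ∀ k < N, (MaxEntSteering.gainWeight N A B ε C₀ CN k).PosDef := fun k hk =>
    MaxEntSteering.gainWeight_posDef hA hε hC₀ hCN hGc hF hk
  refine ⟨fun k hk => MaxEntSteering.qMinus_isUnit hA hε hC₀ hCN hGc hF hk, hL,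
    fun ν₀ hprob hν₀ => ?_⟩
  have hfeas := MaxEntSteering.optPolicy_isFeasible (μN := μN) hA hε hC₀ hCN hGr hF hprob hν₀
  -- The optimal value is a real number that does not involve the initial law, which permits
  -- comparison with policies started from another `ν`.
  have hopt : MaxEntSteering.cost N A B ε ν₀ (MaxEntSteering.optPolicy N A B ε C₀ CN μ₀ μN)
      = (MaxEntSteering.optValue N A B ε C₀ CN μ₀ μN : EReal) := by
    rw [MaxEntSteering.cost_eq hA hε hC₀ hCN hGr hF hfeas fun k hk =>
        MaxEntSteering.energy_optPolicy_ne_top hA hε hC₀ hCN hGc hF hν₀ hk,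
      MaxEntSteering.totalRelEntropy_optPolicy hε hL, EReal.coe_ennreal_zero, add_zero]
  refine ⟨hfeas, fun ν p hf => ?_⟩
  rw [hopt]
  by_cases hE : ∀ k < N, MaxEntSteering.energy A B ν p k ≠ ⊤
  · rw [MaxEntSteering.cost_eq hA hε hC₀ hCN hGr hF hf hE]
    refine ⟨le_add_of_nonneg_right (EReal.coe_ennreal_nonneg _), fun hle k hk => ?_⟩
    refine MaxEntSteering.ae_eq_optPolicy_of_totalRelEntropy_eq_zero hε hL hf.policy ?_ hk
    by_contra hne
    -- Strictness needs the optimal value to be finite: adding a positive, possibly infinite,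
    -- extended real to a real number increases it.
    refine absurd hle (not_le.2 ?_)
    have hpos : (0 : EReal) < (MaxEntSteering.totalRelEntropy N A B ε C₀ CN μ₀ μN ν p : EReal) := by
      rw [← EReal.coe_ennreal_zero, EReal.coe_ennreal_lt_coe_ennreal_iff]
      exact pos_iff_ne_zero.2 hne
    simpa using EReal.add_lt_add_left_coe hpos (MaxEntSteering.optValue N A B ε C₀ CN μ₀ μN)
  · rw [MaxEntSteering.cost, if_neg hE]
    refine ⟨le_top, fun hle => ?_⟩
    exact absurd (top_le_iff.1 hle) (EReal.coe_ne_top _)
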